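/- For a finite simple graph $G$ on $n$ vertices let $L(G)=D(G)-A(G)$ be its integer Laplacian matrix (degree matrix minus adjacency matrix). For $i\ge 1$ let $\Delta_i(G)\geq 0$ be the greatest common divisor of all $i\times i$ minors of $L(G)$, put $\Delta_0(G)=1$, and let $s_i(G)=\Delta_i(G)/\Delta_{i-1}(G)$ be the $i$-th invariant factor of $L(G)$. Write $K_m$ for the complete graph on $m$ vertices, $K_{a,b}$ for the complete bipartite graph with parts of sizes $a$ and $b$, and $C_m$ for the cycle of length $m$. For a graph $H$, $K_m-H$ denotes the graph obtained from $K_m$ by deleting the edges of a copy of $H$ in $K_m$, all vertices being kept; in particular $K_m-e$ is $K_m$ with one edge deleted, $K_m-2e$ is $K_m$ with two edges without a common vertex deleted, and $K_m-2C_3$ is $K_m$ with the six edges of two vertex-disjoint triangles deleted. Let $v\cdot K_m$ be the graph obtained from $K_m$ by adding one new vertex $v$ and one edge joining $v$ to a vertex of $K_m$. Equality of graphs is up to isomorphism. **Theorem.** Let $G\neq K_n$ be a simple connected graph on $n\geq 5$ vertices. Then $s_3(G)\leq n$. Moreover: - $s_3(G)=n$ if and only if $G=K_n-e$; - $s_3(G)=n-1$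 if and only if $G=v\cdot K_{n-1}$; - $s_3(G)=n-2$ if and only if $n=5$ and $G$ is $K_5-2e$ or $K_5-C_4$; - $s_3(G)=n-3$ if and only if $G$ is one of the six graphs $K_{2,3}$, $K_5-C_3$, $K_6-C_3$, $K_7-2C_3$, $K_{3,3}$, $K_7-K_{3,3}$. -/

import Mathlib

/-- The `k`-th determinantal divisor of an integer square matrix: the nonnegative greatest common
divisor of all its `k × k` minors.  Rows and columns are chosen by injections `Fin k ↪ V`, so each
minor occurs up to sign.  For `k = 0` this is `1`, the determinant of the empty matrix. -/
noncomputable def determinantalDivisor {V : Type*} [Fintype V] [DecidableEq V] (M : Matrix V V ℤ) (k : ℕ) : ℕ :=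
  Finset.univ.gcd fun p : (Fin k ↪ V) × (Fin k ↪ V) => (M.submatrix p.1 p.2).det.natAbs

/-- Consecutive determinantal divisors divide each other, so that the quotient in
`invariantFactor` is exact whenever the divisor is nonzero. -/
theorem determinantalDivisor_dvd_succ {V : Type*} [Fintype V] [DecidableEq V]
    (M : Matrix V V ℤ) (k : ℕ) :
    determinantalDivisor M k ∣ determinantalDivisor M (k + 1) := by
  refine Finset.dvd_gcd fun p _ => ?_
  rw [← Int.natCast_dvd, Matrix.det_succ_row_zero]
  refine Finset.dvd_sum fun j _ => Dvd.dvd.mul_left ?_ _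
  rw [Int.natCast_dvd, Matrix.submatrix_submatrix]
  exact Finset.gcd_dvd (f := fun p : (Fin k ↪ V) × (Fin k ↪ V) =>
    (M.submatrix p.1 p.2).det.natAbs)
    (Finset.mem_univ ((Fin.succEmb k).trans p.1, j.succAboveEmb.trans p.2))

/-- The `k`-th invariant factor (`k ≥ 1`) of an integer square matrix, `s_k = Δ_k / Δ_{k-1}`. -/
noncomputable def invariantFactor {V : Type*} [Fintype V] [DecidableEq V] (M : Matrix V V ℤ) (k : ℕ) : ℕ :=
  determinantalDivisor M k / determinantalDivisor M (k - 1)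

/-- The `k`-th invariant factor `s_k(G)` of the integer Laplacian matrix `D(G) - A(G)`. -/
noncomputable def lapInvariantFactor {V : Type*} [Fintype V] [DecidableEq V] (G : SimpleGraph V)
    [DecidableRel G.Adj] (k : ℕ) : ℕ :=
  invariantFactor (G.lapMatrix ℤ) k

/-- `G` is (isomorphic to) `K_m - H`: the complete graph on `m` vertices with the edges of a
copy of `H` deleted. -/
def IsCompleteMinus {V W : Type*} (G : SimpleGraph V) (m : ℕ) (H : SimpleGraph W) : Prop :=
  ∃ f : W ↪ Fin m, Nonempty (G ≃g ((⊤ : SimpleGraph (Fin m)) \ H.map f))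

/-- The graph `v · H`: add to `H` one further vertex `v = none`, joined to the vertex `w` of `H`
and to no other vertex. -/
def addPendant {W : Type*} (H : SimpleGraph W) (w : W) : SimpleGraph (Option W) :=
  H.map Function.Embedding.some ⊔ SimpleGraph.edge none (some w)

/-- `G` is (isomorphic to) `v · K_m`, a complete graph on `m` vertices with a pendant vertex. -/
def IsPendantComplete {V : Type*} (G : SimpleGraph V) (m : ℕ) : Prop :=
  ∃ w : Fin m, Nonempty (G ≃g addPendant (⊤ : SimpleGraph (Fin m)) w)

/-!
A connected graph `G ≠ K_n` contains an induced path `a, b, c`.  The minor of the Laplacian matrix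
`L` in rows `a, b` and columns `b, c` is `1`, so the second determinantal divisor is `1` and
`s_3(G)` is the gcd `D` of all `3 × 3` minors (`lapInvariantFactor_three_eq`).

Bordering this unit minor by a further row and column shows that a number `d` dividing `D` forces
`L i j ≡ -L i b * L a j - (L b b * L a j + L b j) * L i c` modulo `d` for all `i`, `j`
(`PathModulus.dvd_lapMatrix`): modulo `d`, the whole graph is determined by `deg b` and by how
each vertex is attached to the path.  For `d ≥ 2` a vertex outside the path can be adjacent to
exactly `b`, or `a, c`, or `a, b, c`, or `a, b`, or `b, c` (`PathModulus.type_cases`); the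
remaining patterns contradict a congruence or connectedness.  Adjacency between two vertices
depends only on their types, and the degrees of `a`, `b`, `c` are linear in the numbers of vertices
of each type.  So the congruences become divisibility conditions on five natural numbers whose sum
is `n - 3`.  If in addition `d ≥ n - 3`, then `d` is nearly as large as the numbers it has to
divide, and only finitely many solutions remain besides the two infinite families `K_n - e` (where
`d ∣ n`) and `v · K_{n-1}` (where `d ∣ n - 1`); this is `extremal_of_dvd`.  Since it applies to every
divisor `d ≥ n - 3` of `D`, it also rules out `D = 0`, and it gives `D ≤ n`.

Conversely, a matrix that is modulo `d` a sum of two rank-one matrices has all its `3 × 3` minors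
divisible by `d` (`dvd_determinantalDivisor_three`).  For the two families such decompositions
modulo `n` and modulo `n - 1` are written down; for the eight small graphs the congruence above
provides one and is checked by evaluation.  Together with `D ≤ n` this determines `D`, except that
for four graphs on five or six vertices one explicit minor is needed to exclude a proper multiple.
-/

namespace LaplacianFactor

/-! ### Minors and determinantal divisors -/

section Divisors

variable {V : Type*} [Fintype V] [DecidableEq V]

theorem dvd_determinantalDivisor_iff (M : Matrix V V ℤ) (k d : ℕ) :
    d ∣ determinantalDivisor M k ↔
      ∀ r c : Fin k → V, (d : ℤ) ∣ (M.submatrix r c).det := by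
  constructor
  · intro h r c
    by_cases hr : Function.Injective r
    · by_cases hc : Function.Injective c
      · rw [Int.natCast_dvd]
        exact h.trans (Finset.gcd_dvd (f := fun p : (Fin k ↪ V) × (Fin k ↪ V) =>
          (M.submatrix p.1 p.2).det.natAbs) (Finset.mem_univ (⟨r, hr⟩, ⟨c, hc⟩)))
      · simp only [Function.Injective, not_forall] at hc
        obtain ⟨i, j, hij, hne⟩ := hc
        rw [Matrix.det_zero_of_column_eq hne (fun k => by simp [hij])]
        exact dvd_zero _
    · simp only [Function.Injective, not_forall] at hr
      obtain ⟨i, j, hij, hne⟩ := hr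
      rw [Matrix.det_zero_of_row_eq hne (by ext k; simp [hij])]
      exact dvd_zero _
  · intro h
    exact Finset.dvd_gcd fun p _ => Int.natCast_dvd.mp (h _ _)

theorem determinantalDivisor_dvd_det (M : Matrix V V ℤ) (k : ℕ) (r c : Fin k → V) :
    (determinantalDivisor M k : ℤ) ∣ (M.submatrix r c).det :=
  (dvd_determinantalDivisor_iff M k _).mp dvd_rfl r c

theorem determinantalDivisor_submatrix_equiv {W : Type*} [Fintype W] [DecidableEq W]
    (M : Matrix V V ℤ) (e : W ≃ V) (k : ℕ) :
    determinantalDivisor (M.submatrix e e) k = determinantalDivisor M k := by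
  refine Nat.dvd_antisymm ?_ ?_
  · rw [dvd_determinantalDivisor_iff]
    intro r c
    have h := determinantalDivisor_dvd_det (M.submatrix e e) k (e.symm ∘ r) (e.symm ∘ c)
    rwa [Matrix.submatrix_submatrix, ← Function.comp_assoc, ← Function.comp_assoc,
      Equiv.self_comp_symm, Function.id_comp, Function.id_comp] at h
  · rw [dvd_determinantalDivisor_iff]
    intro r c
    rw [Matrix.submatrix_submatrix]
    exact determinantalDivisor_dvd_det M k _ _

/-- A matrix that is modulo `d` a sum of two rank-one matrices has all its `3 × 3` minors
divisible by `d`. -/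
theorem dvd_determinantalDivisor_three (M : Matrix V V ℤ) (d : ℕ) (f g f' g' : V → ℤ)
    (h : ∀ i j, (d : ℤ) ∣ M i j - (f i * g j + f' i * g' j)) :
    d ∣ determinantalDivisor M 3 := by
  rw [dvd_determinantalDivisor_iff]
  intro r c
  have h' : ∀ i j, (M i j : ZMod d) = f i * g j + f' i * g' j := by
    intro i j
    have := (ZMod.intCast_zmod_eq_zero_iff_dvd _ d).mpr (h i j)
    push_cast at this
    exact sub_eq_zero.mp this
  rw [← ZMod.intCast_zmod_eq_zero_iff_dvd, Matrix.det_fin_three]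
  simp only [Matrix.submatrix_apply]
  push_cast
  simp only [h']
  ring

end Divisors

/-! ### The Laplacian matrix and induced paths -/

section Laplacian

variable {V : Type*} (G : SimpleGraph V) [DecidableRel G.Adj]

/-- The entry of the adjacency matrix as an integer. -/
def adj (i j : V) : ℤ := if G.Adj i j then 1 else 0

variable {G}

theorem adj_comm (i j : V) : adj G i j = adj G j i := by
  simp [adj, G.adj_comm]

theorem adj_eq_one {i j : V} : adj G i j = 1 ↔ G.Adj i j := by
  simp [adj]

theorem adj_eq_zero {i j : V} : adj G i j = 0 ↔ ¬ G.Adj i j := by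
  simp [adj]

theorem adj_zero_or_one (i j : V) : adj G i j = 0 ∨ adj G i j = 1 := by
  unfold adj; split_ifs <;> simp

theorem degree_eq_sum_adj [Fintype V] (i : V) : (G.degree i : ℤ) = ∑ j, adj G i j := by
  simp [adj, ← SimpleGraph.card_neighborFinset_eq_degree,
    SimpleGraph.neighborFinset_eq_filter]

theorem exists_induced_path {V : Type*} {G : SimpleGraph V} (hconn : G.Connected)
    (hne : G ≠ ⊤) : ∃ a b c, G.Adj a b ∧ G.Adj b c ∧ a ≠ c ∧ ¬ G.Adj a c := by
  by_contra! h
  apply hne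
  ext u v
  refine ⟨fun h => h.ne, fun huv => ?_⟩
  have key : ∀ {x y : V}, G.Walk x y → x = y ∨ G.Adj x y := by
    intro x y p
    induction p with
    | nil => exact Or.inl rfl
    | @cons x y z hxy _ ih =>
      by_cases hxz : x = z
      · exact Or.inl hxz
      · rcases ih with rfl | ih
        · exact Or.inr hxy
        · exact Or.inr (h _ _ _ hxy ih hxz)
  obtain ⟨p⟩ := hconn.preconnected u v
  exact (key p).resolve_left huv

variable [Fintype V] [DecidableEq V]

theorem lapMatrix_apply_self (i : V) : G.lapMatrix ℤ i i = G.degree i := by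
  simp [SimpleGraph.lapMatrix, SimpleGraph.degMatrix]

theorem lapMatrix_apply_of_ne {i j : V} (h : i ≠ j) : G.lapMatrix ℤ i j = -adj G i j := by
  simp [SimpleGraph.lapMatrix, SimpleGraph.degMatrix, h, adj, SimpleGraph.adjMatrix_apply]

theorem determinantalDivisor_lapMatrix_iso {W : Type*} [Fintype W] [DecidableEq W]
    {H : SimpleGraph W} [DecidableRel H.Adj] (e : G ≃g H) (k : ℕ) :
    determinantalDivisor (G.lapMatrix ℤ) k = determinantalDivisor (H.lapMatrix ℤ) k := by
  rw [← determinantalDivisor_submatrix_equiv (H.lapMatrix ℤ) e.toEquiv k]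
  congr 1
  ext i j
  have hadj : ∀ i j, adj H (e i) (e j) = adj G i j := fun i j => by
    simp [adj, e.map_rel_iff]
  rw [Matrix.submatrix_apply]
  change _ = H.lapMatrix ℤ (e i) (e j)
  by_cases h : i = j
  · subst h
    rw [lapMatrix_apply_self, lapMatrix_apply_self, degree_eq_sum_adj, degree_eq_sum_adj,
      ← e.toEquiv.sum_comp]
    exact Finset.sum_congr rfl fun j _ => (hadj i j).symm
  · rw [lapMatrix_apply_of_ne h, lapMatrix_apply_of_ne (e.injective.ne h), hadj]

/-- An induced path `a, b, c` gives the `2 × 2` minor `1` in rows `a, b` and columns `b, c`. -/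
theorem determinantalDivisor_two_eq_one {a b c : V} (hab : G.Adj a b) (hbc : G.Adj b c)
    (hne : a ≠ c) (hac : ¬ G.Adj a c) : determinantalDivisor (G.lapMatrix ℤ) 2 = 1 := by
  have h := determinantalDivisor_dvd_det (G.lapMatrix ℤ) 2 ![a, b] ![b, c]
  rw [Matrix.det_fin_two] at h
  simp only [Matrix.submatrix_apply, Matrix.cons_val_zero, Matrix.cons_val_one,
    lapMatrix_apply_of_ne hab.ne, lapMatrix_apply_of_ne hbc.ne, lapMatrix_apply_of_ne hne,
    adj_eq_one.mpr hab, adj_eq_one.mpr hbc, adj_eq_zero.mpr hac] at h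
  norm_num at h
  exact_mod_cast Int.eq_one_of_dvd_one (by positivity) h

theorem lapInvariantFactor_three_eq (hconn : G.Connected) (hne : G ≠ ⊤) :
    lapInvariantFactor G 3 = determinantalDivisor (G.lapMatrix ℤ) 3 := by
  obtain ⟨a, b, c, hab, hbc, hac, hnac⟩ := exists_induced_path hconn hne
  rw [lapInvariantFactor, invariantFactor, determinantalDivisor_two_eq_one hab hbc hac hnac,
    Nat.div_one]

end Laplacian

/-! ### Recognizing the extremal graphs -/

section Recognition

variable {V : Type*} {G : SimpleGraph V}

theorem map_embedding_adj {W : Type*} (H : SimpleGraph W) (φ : W ↪ V) (u v : V) :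
    (H.map φ).Adj u v ↔ ∃ x y, H.Adj x y ∧ φ x = u ∧ φ y = v := by
  constructor
  · rintro ⟨-, h⟩
    exact h
  · rintro ⟨x, y, h, rfl, rfl⟩
    exact ⟨φ.injective.ne h.ne, x, y, h, rfl, rfl⟩

theorem isCompleteMinus_of_embedding {W : Type*} [Fintype V] {H : SimpleGraph W} {m : ℕ}
    (hm : Fintype.card V = m) (φ : W ↪ V)
    (h : ∀ u v, u ≠ v → (¬ G.Adj u v ↔ ∃ x y, H.Adj x y ∧ φ x = u ∧ φ y = v)) :
    IsCompleteMinus G m H := by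
  let e : V ≃ Fin m := Fintype.equivFinOfCardEq hm
  refine ⟨φ.trans e.toEmbedding, ⟨⟨e, ?_⟩⟩⟩
  intro u v
  rw [SimpleGraph.sdiff_adj, SimpleGraph.top_adj, map_embedding_adj]
  simp only [Function.Embedding.trans_apply, Equiv.coe_toEmbedding, e.apply_eq_iff_eq, ne_eq]
  by_cases huv : u = v
  · simp [huv]
  · rw [← h u v huv]
    simp [huv]

/-- Whether a graph is `K_m - H` does not depend on where the copy of `H` lies. -/
theorem nonempty_iso_of_isCompleteMinus {W : Type*} [Finite W] {H : SimpleGraph W} {m : ℕ}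
    (h : IsCompleteMinus G m H) (g : W ↪ Fin m) :
    Nonempty (G ≃g ((⊤ : SimpleGraph (Fin m)) \ H.map g)) := by
  obtain ⟨f, ⟨e⟩⟩ := h
  obtain ⟨k, ⟨ε⟩⟩ := Finite.exists_equiv_fin W
  have := Equiv.Perm.isMultiplyPretransitive (Fin m) k
  rw [MulAction.isMultiplyPretransitive_iff] at this
  obtain ⟨σ, hσ⟩ := this (ε.symm.toEmbedding.trans f) (ε.symm.toEmbedding.trans g)
  have hσ' : ∀ w, σ (f w) = g w := by
    intro w
    have := DFunLike.congr_fun hσ (ε w)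
    simpa using this
  refine ⟨e.trans ⟨σ, ?_⟩⟩
  intro u v
  simp only [SimpleGraph.sdiff_adj, SimpleGraph.top_adj, map_embedding_adj, ← hσ',
    σ.apply_eq_iff_eq, ne_eq]

theorem isCompleteMinus_congr {W W' : Type*} {H : SimpleGraph W} {H' : SimpleGraph W'} {m : ℕ}
    (h : IsCompleteMinus G m H) (e : H ≃g H') : IsCompleteMinus G m H' := by
  obtain ⟨f, ⟨i⟩⟩ := h
  refine ⟨e.symm.toEquiv.toEmbedding.trans f, ?_⟩
  have : H'.map (e.symm.toEquiv.toEmbedding.trans f) = H.map f := by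
    ext u v
    rw [map_embedding_adj, map_embedding_adj]
    constructor
    · rintro ⟨x, y, hxy, rfl, rfl⟩
      exact ⟨e.symm x, e.symm y, e.symm.map_rel_iff.mpr hxy, rfl, rfl⟩
    · rintro ⟨x, y, hxy, rfl, rfl⟩
      exact ⟨e x, e y, e.map_rel_iff.mpr hxy, by simp, by simp⟩
  rw [this]
  exact ⟨i⟩

theorem exists_embedding_range (S : Finset V) {k : ℕ} (hS : S.card = k) :
    ∃ φ : Fin k ↪ V, ∀ v, v ∈ S ↔ ∃ i, φ i = v := by
  let e := S.equivFinOfCardEq hS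
  refine ⟨e.symm.toEmbedding.trans (Function.Embedding.subtype _), fun v => ?_⟩
  constructor
  · intro hv
    exact ⟨e ⟨v, hv⟩, by simp⟩
  · rintro ⟨i, rfl⟩
    simp

theorem exists_sum_embedding_range (S T : Finset V) (hST : Disjoint S T) {k l : ℕ}
    (hS : S.card = k) (hT : T.card = l) :
    ∃ φ : Fin k ⊕ Fin l ↪ V, (∀ v, v ∈ S ↔ ∃ i, φ (.inl i) = v) ∧
      ∀ v, v ∈ T ↔ ∃ i, φ (.inr i) = v := by
  obtain ⟨f, hf⟩ := exists_embedding_range S hS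
  obtain ⟨g, hg⟩ := exists_embedding_range T hT
  refine ⟨⟨Sum.elim f g, f.injective.sumElim g.injective fun i j hij => ?_⟩, hf, hg⟩
  exact Finset.disjoint_left.mp hST ((hf _).mpr ⟨i, rfl⟩) ((hg _).mpr ⟨j, hij.symm⟩)

theorem nonempty_iso_completeBipartite {k l : ℕ} (S T : Finset V)
    (hST : Disjoint S T) (hcover : ∀ v, v ∈ S ∨ v ∈ T) (hS : S.card = k) (hT : T.card = l)
    (h : ∀ u v, u ≠ v → (G.Adj u v ↔ (u ∈ S ∧ v ∈ T) ∨ (u ∈ T ∧ v ∈ S))) :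
    Nonempty (G ≃g completeBipartiteGraph (Fin k) (Fin l)) := by
  obtain ⟨φ, hφ, hψ⟩ := exists_sum_embedding_range S T hST hS hT
  have hsurj : Function.Surjective φ := by
    intro v
    rcases hcover v with hv | hv
    · obtain ⟨i, hi⟩ := (hφ v).mp hv
      exact ⟨_, hi⟩
    · obtain ⟨i, hi⟩ := (hψ v).mp hv
      exact ⟨_, hi⟩
  refine ⟨(RelIso.mk (Equiv.ofBijective φ ⟨φ.injective, hsurj⟩) ?_).symm⟩
  intro x y
  change G.Adj (φ x) (φ y) ↔ _
  by_cases hxy : x = y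
  · simp [hxy]
  · rw [h _ _ (φ.injective.ne hxy), hφ, hφ, hψ, hψ]
    rcases x with i | i <;> rcases y with j | j <;> simp

variable [Fintype V]

theorem isCompleteMinus_top {m k : ℕ} (hm : Fintype.card V = m) (S : Finset V)
    (hS : S.card = k) (h : ∀ u v, u ≠ v → (¬ G.Adj u v ↔ u ∈ S ∧ v ∈ S)) :
    IsCompleteMinus G m (⊤ : SimpleGraph (Fin k)) := by
  obtain ⟨φ, hφ⟩ := exists_embedding_range S hS
  refine isCompleteMinus_of_embedding hm φ fun u v huv => ?_
  rw [h u v huv, hφ, hφ]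
  constructor
  · rintro ⟨⟨i, rfl⟩, j, rfl⟩
    exact ⟨i, j, fun hij => huv (congrArg φ hij), rfl, rfl⟩
  · rintro ⟨i, j, -, hi, hj⟩
    exact ⟨⟨i, hi⟩, j, hj⟩

theorem isCompleteMinus_top_sum_top {m k l : ℕ} (hm : Fintype.card V = m) (S T : Finset V)
    (hST : Disjoint S T) (hS : S.card = k) (hT : T.card = l)
    (h : ∀ u v, u ≠ v → (¬ G.Adj u v ↔ (u ∈ S ∧ v ∈ S) ∨ (u ∈ T ∧ v ∈ T))) :
    IsCompleteMinus G m ((⊤ : SimpleGraph (Fin k)) ⊕g (⊤ : SimpleGraph (Fin l))) := by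
  obtain ⟨φ, hφ, hψ⟩ := exists_sum_embedding_range S T hST hS hT
  refine isCompleteMinus_of_embedding hm φ fun u v huv => ?_
  rw [h u v huv, hφ, hφ, hψ, hψ]
  constructor
  · rintro (⟨⟨i, rfl⟩, j, rfl⟩ | ⟨⟨i, rfl⟩, j, rfl⟩)
    · exact ⟨.inl i, .inl j, fun hij => huv (by rw [hij]), rfl, rfl⟩
    · exact ⟨.inr i, .inr j, fun hij => huv (by rw [hij]), rfl, rfl⟩
  · rintro ⟨i | i, j | j, hij, hi, hj⟩
    · exact Or.inl ⟨⟨i, hi⟩, j, hj⟩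
    · exact absurd hij (by simp)
    · exact absurd hij (by simp)
    · exact Or.inr ⟨⟨i, hi⟩, j, hj⟩

theorem isCompleteMinus_completeBipartite {m k l : ℕ} (hm : Fintype.card V = m) (S T : Finset V)
    (hST : Disjoint S T) (hS : S.card = k) (hT : T.card = l)
    (h : ∀ u v, u ≠ v → (¬ G.Adj u v ↔ (u ∈ S ∧ v ∈ T) ∨ (u ∈ T ∧ v ∈ S))) :
    IsCompleteMinus G m (completeBipartiteGraph (Fin k) (Fin l)) := by
  obtain ⟨φ, hφ, hψ⟩ := exists_sum_embedding_range S T hST hS hT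
  refine isCompleteMinus_of_embedding hm φ fun u v huv => ?_
  rw [h u v huv, hφ, hφ, hψ, hψ]
  constructor
  · rintro (⟨⟨i, rfl⟩, j, rfl⟩ | ⟨⟨i, rfl⟩, j, rfl⟩)
    · exact ⟨.inl i, .inr j, by simp, rfl, rfl⟩
    · exact ⟨.inr i, .inl j, by simp, rfl, rfl⟩
  · rintro ⟨i | i, j | j, hij, hi, hj⟩
    · simp at hij
    · exact Or.inl ⟨⟨i, hi⟩, j, hj⟩
    · exact Or.inr ⟨⟨i, hi⟩, j, hj⟩
    · simp at hij

theorem isPendantComplete_of [DecidableEq V] {m : ℕ} (hm : Fintype.card V = m + 1) (b c : V)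
    (hbc : b ≠ c) (h : ∀ u v, u ≠ v → (G.Adj u v ↔ (u = c → v = b) ∧ (v = c → u = b))) :
    IsPendantComplete G m := by
  have hcard : Fintype.card {v // v ≠ c} = m := by
    simp [hm]
  let e : {v // v ≠ c} ≃ Fin m := Fintype.equivFinOfCardEq hcard
  refine ⟨e ⟨b, hbc⟩, ⟨RelIso.mk ((Equiv.optionSubtypeNe c).symm.trans e.optionCongr) ?_⟩⟩
  intro u v
  have hsome : ∀ x : V, (hx : x ≠ c) →
      ((Equiv.optionSubtypeNe c).symm.trans e.optionCongr) x = some (e ⟨x, hx⟩) := by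
    intro x hx
    simp [hx]
  have hnone : ((Equiv.optionSubtypeNe c).symm.trans e.optionCongr) c = none := by simp
  by_cases huv : u = v
  · simp [huv]
  rw [h u v huv, addPendant, SimpleGraph.sup_adj, map_embedding_adj, SimpleGraph.edge_adj]
  by_cases hu : u = c <;> by_cases hv : v = c
  · exact absurd (hu.trans hv.symm) huv
  · subst hu
    rw [hnone, hsome v hv]
    simp [hv, eq_comm]
  · subst hv
    rw [hnone, hsome u hu]
    simp [hu]
  · rw [hsome u hu, hsome v hv]
    simp [hu, hv, huv]

end Recognition

/-! ### Congruences along an induced path -/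

section Path

variable {V : Type*} [Fintype V] [DecidableEq V] {G : SimpleGraph V} [DecidableRel G.Adj]

/-- `a, b, c` is an induced path in the connected graph `G`, and `d ≥ 2` divides all `3 × 3`
minors of the Laplacian matrix of `G`. -/
structure PathModulus (G : SimpleGraph V) [DecidableRel G.Adj] (d : ℕ) (a b c : V) : Prop where
  conn : G.Connected
  two_le : 2 ≤ d
  dvd : d ∣ determinantalDivisor (G.lapMatrix ℤ) 3
  adj_ab : G.Adj a b
  adj_bc : G.Adj b c
  ne_ac : a ≠ c
  not_adj_ac : ¬ G.Adj a c

/-- `v` lies outside `{a, b, c}`, and `x`, `y`, `z` (each `0` or `1`) record its adjacency to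
`a`, `b`, `c`. -/
def HasType (G : SimpleGraph V) [DecidableRel G.Adj] (a b c : V) (x y z : ℤ) (v : V) : Prop :=
  v ≠ a ∧ v ≠ b ∧ v ≠ c ∧ adj G v a = x ∧ adj G v b = y ∧ adj G v c = z

instance (a b c : V) (x y z : ℤ) : DecidablePred (HasType G a b c x y z) :=
  fun _ => inferInstanceAs (Decidable (_ ∧ _))

/-- The set of vertices of a given type. -/
def cell (G : SimpleGraph V) [DecidableRel G.Adj] (a b c : V) (x y z : ℤ) : Finset V :=
  Finset.univ.filter (HasType G a b c x y z)

theorem mem_cell {a b c : V} {x y z : ℤ} {v : V} :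
    v ∈ cell G a b c x y z ↔ HasType G a b c x y z v := by
  simp [cell]

namespace PathModulus

variable {d : ℕ} {a b c : V} (h : PathModulus G d a b c)

include h

theorem ne_ab : a ≠ b := h.adj_ab.ne

theorem ne_bc : b ≠ c := h.adj_bc.ne

theorem symm : PathModulus G d c b a :=
  ⟨h.conn, h.two_le, h.dvd, h.adj_bc.symm, h.adj_ab.symm, h.ne_ac.symm,
    fun hca => h.not_adj_ac hca.symm⟩

theorem adj_eq_ab : adj G a b = 1 := adj_eq_one.mpr h.adj_ab

theorem adj_eq_bc : adj G b c = 1 := adj_eq_one.mpr h.adj_bc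

theorem adj_eq_ac : adj G a c = 0 := adj_eq_zero.mpr h.not_adj_ac

/-- The minor in rows `a, b, i` and columns `b, c, j` vanishes modulo `d`.  The minor in rows
`a, b` and columns `b, c` is `1`, so this expresses the entry `(i, j)` through rows `a, b` and
columns `b, c`. -/
theorem dvd_lapMatrix (i j : V) :
    (d : ℤ) ∣ G.lapMatrix ℤ i j + G.lapMatrix ℤ i b * G.lapMatrix ℤ a j +
      (G.lapMatrix ℤ b b * G.lapMatrix ℤ a j + G.lapMatrix ℤ b j) * G.lapMatrix ℤ i c := by
  have hm := (dvd_determinantalDivisor_iff _ _ _).mp h.dvd ![a, b, i] ![b, c, j]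
  rw [Matrix.det_fin_three] at hm
  simp only [Matrix.submatrix_apply, Matrix.cons_val_zero, Matrix.cons_val_one,
    Matrix.cons_val, lapMatrix_apply_of_ne h.ne_ab, lapMatrix_apply_of_ne h.ne_bc,
    lapMatrix_apply_of_ne h.ne_ac, h.adj_eq_ab, h.adj_eq_bc, h.adj_eq_ac] at hm
  convert! hm using 1
  ring

/-- The congruence of `dvd_lapMatrix` for the entry `(c, a)`, which relates the two ends. -/
theorem dvd_ends : (d : ℤ) ∣ G.degree a + G.degree c - G.degree a * G.degree b * G.degree c := by
  have hm := h.dvd_lapMatrix c a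
  rw [lapMatrix_apply_of_ne h.ne_ac.symm, lapMatrix_apply_of_ne h.ne_bc.symm,
    lapMatrix_apply_of_ne h.ne_ab.symm, lapMatrix_apply_self, lapMatrix_apply_self,
    lapMatrix_apply_self, adj_comm c a, adj_comm c b, adj_comm b a, h.adj_eq_ab, h.adj_eq_bc,
    h.adj_eq_ac] at hm
  rw [← dvd_neg]
  convert! hm using 1
  ring

variable {i j : V} {x y z x' y' z' : ℤ}

/-- Modulo `d`, the types of two vertices decide whether they are adjacent. -/
theorem dvd_pair (hi : HasType G a b c x y z i) (hj : HasType G a b c x' y' z' j) (hij : i ≠ j) :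
    (d : ℤ) ∣ adj G i j - (y * x' + y' * z + G.degree b * x' * z) := by
  obtain ⟨ia, ib, ic, rfl, rfl, rfl⟩ := hi
  obtain ⟨ja, jb, jc, rfl, rfl, rfl⟩ := hj
  have hm := h.dvd_lapMatrix i j
  rw [lapMatrix_apply_of_ne hij, lapMatrix_apply_of_ne ib, lapMatrix_apply_of_ne ja.symm,
    lapMatrix_apply_self, lapMatrix_apply_of_ne jb.symm, lapMatrix_apply_of_ne ic,
    adj_comm a j, adj_comm b j] at hm
  rw [← dvd_neg]
  convert! hm using 1
  ring

/-- The congruence of `dvd_lapMatrix` for the column of `a`. -/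
theorem dvd_left (hi : HasType G a b c x y z i) :
    (d : ℤ) ∣ x - z + G.degree a * (G.degree b * z + y) := by
  obtain ⟨ia, ib, ic, rfl, rfl, rfl⟩ := hi
  have hm := h.dvd_lapMatrix i a
  rw [lapMatrix_apply_of_ne ia, lapMatrix_apply_of_ne ib, lapMatrix_apply_self,
    lapMatrix_apply_self, lapMatrix_apply_of_ne h.ne_ab.symm, lapMatrix_apply_of_ne ic,
    adj_comm b a, h.adj_eq_ab] at hm
  rw [← dvd_neg]
  convert! hm using 1
  ring

/-- The mirror image of `dvd_left`. -/
theorem dvd_right (hj : HasType G a b c x y z j) :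
    (d : ℤ) ∣ z - x + G.degree c * (G.degree b * x + y) := by
  obtain ⟨ja, jb, jc, hx, hy, hz⟩ := hj
  exact h.symm.dvd_left ⟨jc, jb, ja, hz, hy, hx⟩

theorem not_dvd_one {e : ℤ} (he : e = 1 ∨ e = -1) : ¬ (d : ℤ) ∣ e := by
  intro hd
  have h1 : (d : ℤ) ∣ 1 := by
    rcases he with rfl | rfl
    · exact hd
    · rwa [dvd_neg] at hd
  have := Int.le_of_dvd one_pos h1
  have := h.two_le
  omega

theorem adj_eq_zero_of_dvd {u v : V} (hd : (d : ℤ) ∣ adj G u v) : ¬ G.Adj u v := by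
  intro huv
  rw [adj_eq_one.mpr huv] at hd
  exact h.not_dvd_one (Or.inl rfl) hd

theorem adj_of_dvd {u v : V} (hd : (d : ℤ) ∣ adj G u v - 1) : G.Adj u v := by
  by_contra huv
  rw [adj_eq_zero.mpr huv] at hd
  exact h.not_dvd_one (Or.inr rfl) hd

/-- Only five of the eight adjacency patterns to the path occur: a vertex with no neighbour on
the path would be isolated, and one adjacent to exactly one end violates a congruence. -/
theorem type_cases (v : V) : v = a ∨ v = b ∨ v = c ∨ HasType G a b c 0 1 0 v ∨
    HasType G a b c 1 0 1 v ∨ HasType G a b c 1 1 1 v ∨ HasType G a b c 1 1 0 v ∨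
    HasType G a b c 0 1 1 v := by
  by_cases ha : v = a
  · exact Or.inl ha
  by_cases hb : v = b
  · exact Or.inr (Or.inl hb)
  by_cases hc : v = c
  · exact Or.inr (Or.inr (Or.inl hc))
  have hv : HasType G a b c (adj G v a) (adj G v b) (adj G v c) v := ⟨ha, hb, hc, rfl, rfl, rfl⟩
  rcases adj_zero_or_one (G := G) v a with h1 | h1 <;>
    rcases adj_zero_or_one (G := G) v b with h2 | h2 <;>
    rcases adj_zero_or_one (G := G) v c with h3 | h3 <;>
    rw [h1, h2, h3] at hv <;> try tauto
  · exfalso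
    have : Nontrivial V := ⟨v, a, ha⟩
    obtain ⟨w, hw⟩ := h.conn.preconnected.exists_adj_of_nontrivial v
    by_cases wa : w = a
    · exact adj_eq_zero.mp h1 (wa ▸ hw)
    by_cases wb : w = b
    · exact adj_eq_zero.mp h2 (wb ▸ hw)
    by_cases wc : w = c
    · exact adj_eq_zero.mp h3 (wc ▸ hw)
    have hp := h.dvd_pair hv ⟨wa, wb, wc, rfl, rfl, rfl⟩ hw.ne
    simp only [zero_mul, mul_zero, add_zero, sub_zero] at hp
    exact h.adj_eq_zero_of_dvd hp hw
  · exfalso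
    have hr := h.dvd_right hv
    simp only [mul_zero, add_zero] at hr
    exact h.not_dvd_one (Or.inl (by norm_num)) hr
  · exfalso
    have hl := h.dvd_left hv
    simp only [mul_zero, add_zero] at hl
    exact h.not_dvd_one (Or.inl (by norm_num)) hl

/-- Summation of a function that is constant on each of the cells. -/
theorem sum_eq (f : V → ℤ) (f₁ f₂ f₃ f₄ f₅ : ℤ)
    (h₁ : ∀ v, HasType G a b c 0 1 0 v → f v = f₁) (h₂ : ∀ v, HasType G a b c 1 0 1 v → f v = f₂)
    (h₃ : ∀ v, HasType G a b c 1 1 1 v → f v = f₃) (h₄ : ∀ v, HasType G a b c 1 1 0 v → f v = f₄)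
    (h₅ : ∀ v, HasType G a b c 0 1 1 v → f v = f₅) :
    ∑ v, f v = f a + f b + f c + (cell G a b c 0 1 0).card * f₁ +
      (cell G a b c 1 0 1).card * f₂ + (cell G a b c 1 1 1).card * f₃ +
      (cell G a b c 1 1 0).card * f₄ + (cell G a b c 0 1 1).card * f₅ := by
  have key : ∀ v, f v = (if v = a then f a else 0) + (if v = b then f b else 0) +
      (if v = c then f c else 0) + (if HasType G a b c 0 1 0 v then f₁ else 0) +
      (if HasType G a b c 1 0 1 v then f₂ else 0) + (if HasType G a b c 1 1 1 v then f₃ else 0) +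
      (if HasType G a b c 1 1 0 v then f₄ else 0) +
      (if HasType G a b c 0 1 1 v then f₅ else 0) := by
    intro v
    have hab := h.ne_ab
    have hbc := h.ne_bc
    have hac := h.ne_ac
    rcases h.type_cases v with rfl | rfl | rfl | hv | hv | hv | hv | hv
    · simp [HasType, hab, hac]
    · simp [HasType, hab.symm, hbc]
    · simp [HasType, hac.symm, hbc.symm]
    · rw [h₁ v hv]
      obtain ⟨va, vb, vc, e1, e2, e3⟩ := hv
      simp [HasType, va, vb, vc, e1, e2, e3]
    · rw [h₂ v hv]
      obtain ⟨va, vb, vc, e1, e2, e3⟩ := hv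
      simp [HasType, va, vb, vc, e1, e2, e3]
    · rw [h₃ v hv]
      obtain ⟨va, vb, vc, e1, e2, e3⟩ := hv
      simp [HasType, va, vb, vc, e1, e2, e3]
    · rw [h₄ v hv]
      obtain ⟨va, vb, vc, e1, e2, e3⟩ := hv
      simp [HasType, va, vb, vc, e1, e2, e3]
    · rw [h₅ v hv]
      obtain ⟨va, vb, vc, e1, e2, e3⟩ := hv
      simp [HasType, va, vb, vc, e1, e2, e3]
  rw [Finset.sum_congr rfl fun v _ => key v]
  simp only [Finset.sum_add_distrib, Finset.sum_ite_eq', Finset.mem_univ, if_true,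
    ← Finset.sum_filter, Finset.sum_const, nsmul_eq_mul, cell]

theorem card_eq : (Fintype.card V : ℤ) = 3 + (cell G a b c 0 1 0).card +
    (cell G a b c 1 0 1).card + (cell G a b c 1 1 1).card + (cell G a b c 1 1 0).card +
    (cell G a b c 0 1 1).card := by
  have := h.sum_eq (fun _ => 1) 1 1 1 1 1 (fun _ _ => rfl) (fun _ _ => rfl) (fun _ _ => rfl)
    (fun _ _ => rfl) (fun _ _ => rfl)
  simpa using this

theorem degree_left : (G.degree a : ℤ) = 1 + (cell G a b c 1 0 1).card +
    (cell G a b c 1 1 1).card + (cell G a b c 1 1 0).card := by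
  rw [degree_eq_sum_adj, h.sum_eq (fun v => adj G a v) 0 1 1 1 0]
  · rw [adj_eq_zero.mpr (G.irrefl (v := a)), h.adj_eq_ab, h.adj_eq_ac]
    ring
  all_goals
    intro v hv
    rw [adj_comm]
    exact hv.2.2.2.1

theorem degree_middle : (G.degree b : ℤ) = 2 + (cell G a b c 0 1 0).card +
    (cell G a b c 1 1 1).card + (cell G a b c 1 1 0).card + (cell G a b c 0 1 1).card := by
  rw [degree_eq_sum_adj, h.sum_eq (fun v => adj G b v) 1 0 1 1 1]
  · rw [adj_eq_zero.mpr (G.irrefl (v := b)), adj_comm b a, h.adj_eq_ab, h.adj_eq_bc]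
    ring
  all_goals
    intro v hv
    rw [adj_comm]
    exact hv.2.2.2.2.1

theorem degree_right : (G.degree c : ℤ) = 1 + (cell G a b c 1 0 1).card +
    (cell G a b c 1 1 1).card + (cell G a b c 0 1 1).card := by
  rw [degree_eq_sum_adj, h.sum_eq (fun v => adj G c v) 0 1 1 0 1]
  · rw [adj_eq_zero.mpr (G.irrefl (v := c)), adj_comm c a, adj_comm c b, h.adj_eq_ac, h.adj_eq_bc]
    ring
  all_goals
    intro v hv
    rw [adj_comm]
    exact hv.2.2.2.2.2

end PathModulus

end Path

/-! ### Solving the congruences -/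

section Arithmetic

theorem eq_or_eq_two_mul_of_dvd {d x : ℤ} (hx : 0 < x) (hlt : x < 3 * d) (h : d ∣ x) :
    x = d ∨ x = 2 * d := by
  obtain ⟨k, rfl⟩ := h
  have hd : 0 < d := by linarith
  have h1 : 0 < k := pos_of_mul_pos_right hx hd.le
  have h2 : k < 3 := by nlinarith
  obtain rfl | rfl : k = 1 ∨ k = 2 := by omega
  · exact Or.inl (by ring)
  · exact Or.inr (by ring)

/-! In the next lemmas `p`, `q`, `r`, `u`, `w` stand for the numbers of vertices whose adjacency to
`a, b, c` is `(0, 1, 0)`, `(1, 0, 1)`, `(1, 1, 1)`, `(1, 1, 0)`, `(0, 1, 1)`.  Types that do not occur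
are left out; then `n - 3` is the sum of the remaining variables, and the hypothesis that this sum
is at most `d` keeps the quotients small. -/

variable {p q r u w d : ℤ}

theorem solve_middle_type (hp : 1 ≤ p) (hq : 0 ≤ q) (hr : 0 ≤ r) (hd : p + q + r ≤ d)
    (h2 : 2 ≤ d) (h1 : d ∣ 1 + q + r) (hqq : 2 ≤ q → d ∣ 2 + p + r ∨ d ∣ 1 + p + r)
    (hqr : 1 ≤ q → 1 ≤ r → d ∣ 3 + p + r ∨ d ∣ 2 + p + r)
    (hrr : 2 ≤ r → d ∣ 4 + p + r ∨ d ∣ 3 + p + r) :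
    p = 1 ∧ d = 1 + q + r ∧ ((q = 2 ∧ r = 0) ∨ (q = 2 ∧ r = 1) ∨ (q = 1 ∧ r = 0) ∨
      (q = 0 ∧ r = 1) ∨ (q = 0 ∧ r = 2) ∨ (q = 0 ∧ r = 3)) := by
  have hle := Int.le_of_dvd (by omega) h1
  obtain rfl : p = 1 := by omega
  obtain rfl : d = 1 + q + r := by omega
  refine ⟨rfl, rfl, ?_⟩
  by_cases q2 : 2 ≤ q
  · have : q = 2 := by
      rcases hqq q2 with h | h <;> have := Int.le_of_dvd (by omega) h <;> omega
    subst this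
    by_cases r2 : 2 ≤ r
    · rcases hrr r2 with h | h <;>
        have := eq_or_eq_two_mul_of_dvd (by omega) (by omega) h <;> omega
    · omega
  · by_cases q1 : 1 ≤ q
    · by_cases r1 : 1 ≤ r
      · rcases hqr q1 r1 with h | h <;>
        have := eq_or_eq_two_mul_of_dvd (by omega) (by omega) h <;> omega
      · omega
    · by_cases r2 : 2 ≤ r
      · rcases hrr r2 with h | h <;>
          have := eq_or_eq_two_mul_of_dvd (by omega) (by omega) h <;> omega
      · omega

theorem solve_ends_type (hq : 1 ≤ q) (hr : 0 ≤ r) (hqr0 : 2 ≤ q + r) (hd : q + r ≤ d)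
    (h1 : d ∣ (1 + q + r) * (2 + r)) (hends : d ∣ 2 * (1 + q + r))
    (hqq : 2 ≤ q → d ∣ 2 + r ∨ d ∣ 1 + r)
    (hqr : 1 ≤ r → d ∣ 3 + r ∨ d ∣ 2 + r) (hrr : 2 ≤ r → d ∣ 4 + r ∨ d ∣ 3 + r) :
    (q = 1 ∧ r = 1 ∧ d = 3) ∨ (q = 2 ∧ r = 0 ∧ d = 2) := by
  have hsmall : d = 2 * (1 + q + r) ∨ d = 1 + q + r ∨ (d = 2 ∧ q + r = 2) := by
    by_cases hlt : 2 * (1 + q + r) < 3 * d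
    · rcases eq_or_eq_two_mul_of_dvd (by omega) hlt hends with h | h <;> omega
    · omega
  rcases hsmall with h | h | ⟨h, h'⟩
  · exfalso
    by_cases q2 : 2 ≤ q
    · rcases hqq q2 with h' | h' <;> have := Int.le_of_dvd (by omega) h' <;> omega
    · rcases hqr (by omega) with h' | h' <;> have := Int.le_of_dvd (by omega) h' <;> omega
  · left
    by_cases q2 : 2 ≤ q
    · exfalso
      rcases hqq q2 with h' | h' <;> have := Int.le_of_dvd (by omega) h' <;> omega
    · by_cases r2 : 2 ≤ r
      · rcases hrr r2 with h | h <;>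
          have := eq_or_eq_two_mul_of_dvd (by omega) (by omega) h <;> omega
      · omega
  · obtain ⟨rfl, rfl⟩ | ⟨rfl, rfl⟩ : (q = 1 ∧ r = 1) ∨ (q = 2 ∧ r = 0) := by omega
    · rw [h] at h1
      norm_num at h1
    · exact Or.inr ⟨rfl, rfl, h⟩

theorem solve_full_type (hr : 2 ≤ r) (hd : r ≤ d) (h1 : d ∣ (1 + r) * (3 + r))
    (hrr : d ∣ 4 + r ∨ d ∣ 3 + r) : d ∣ 3 + r ∨ (r = 2 ∧ d = 3) := by
  rcases hrr with h | h
  · right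
    -- `(1 + r) * (3 + r) - r * (4 + r) = 3`
    have h3 : d ∣ 3 := by
      have := dvd_sub h1 (h.mul_left r)
      ring_nf at this
      exact this
    have h3' := Int.le_of_dvd (by norm_num) h3
    obtain rfl | rfl : d = 2 ∨ d = 3 := by omega
    · omega
    · omega
  · exact Or.inl h

theorem solve_one_side (hq : 0 ≤ q) (hu : 1 ≤ u) (hd : q + u ≤ d) (h1 : d ∣ 2 + q + u)
    (hqu : 1 ≤ q → d ∣ 2 + u) : q = 0 ∧ d ∣ 2 + u := by
  have : q = 0 := by
    by_contra hne
    have := dvd_sub h1 (hqu (by omega))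
    have := Int.le_of_dvd (by omega) this
    omega
  subst this
  simpa using h1

theorem solve_two_sides (hq : 0 ≤ q) (hu : 1 ≤ u) (hw : 1 ≤ w) (hd : q + u + w ≤ d)
    (h1 : d ∣ 2 + q + u) (h2 : d ∣ 2 + q + w) (h3 : d ∣ 4 + u + w)
    (hquw : 1 ≤ q → d ∣ 2 + u + w) :
    q = 0 ∧ ((u = 1 ∧ w = 1 ∧ d = 3) ∨ (u = 2 ∧ w = 2 ∧ d = 4)) := by
  have hu2 := Int.le_of_dvd (by omega) h1
  have hw2 := Int.le_of_dvd (by omega) h2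
  have : q = 0 := by
    by_contra hne
    have := dvd_sub h3 (hquw (by omega))
    have := Int.le_of_dvd (by omega) this
    omega
  subst this
  refine ⟨rfl, ?_⟩
  obtain ⟨rfl | rfl, rfl | rfl⟩ : (u = 1 ∨ u = 2) ∧ (w = 1 ∨ w = 2) := by omega
  all_goals
    have h : d = 2 ∨ d = 3 ∨ d = 4 := by omega
    rcases h with rfl | rfl | rfl <;> omega

end Arithmetic

/-! ### Adjacency determined by types -/

section Classification

variable {V : Type*} [Fintype V] [DecidableEq V] {G : SimpleGraph V} [DecidableRel G.Adj]

namespace PathModulus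

variable {d : ℕ} {a b c : V} (h : PathModulus G d a b c)

include h

variable {i j : V} {x y z x' y' z' : ℤ}

/-- Whether `i` and `j` are adjacent or not, the congruence for the pair gives a divisibility that
involves only their types. -/
theorem dvd_or_dvd_of_type (hi : HasType G a b c x y z i) (hj : HasType G a b c x' y' z' j)
    (hij : i ≠ j) : (d : ℤ) ∣ y * x' + y' * z + G.degree b * x' * z ∨
      (d : ℤ) ∣ y * x' + y' * z + G.degree b * x' * z - 1 := by
  have hp := h.dvd_pair hi hj hij
  rcases adj_zero_or_one (G := G) i j with e | e <;> rw [e] at hp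
  · left
    rwa [zero_sub, dvd_neg] at hp
  · right
    rwa [dvd_sub_comm] at hp

theorem dvd_or_dvd_of_two_le_card (hc : 2 ≤ (cell G a b c x y z).card) :
    (d : ℤ) ∣ y * x + y * z + G.degree b * x * z ∨
      (d : ℤ) ∣ y * x + y * z + G.degree b * x * z - 1 := by
  obtain ⟨i, hi, j, hj, hij⟩ := Finset.one_lt_card.mp hc
  exact h.dvd_or_dvd_of_type (mem_cell.mp hi) (mem_cell.mp hj) hij

theorem adj_of_type (hi : HasType G a b c x y z i) (hj : HasType G a b c x' y' z' j)
    (hij : i ≠ j) (hd : (d : ℤ) ∣ y * x' + y' * z + G.degree b * x' * z - 1) : G.Adj i j :=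
  h.adj_of_dvd (by simpa using dvd_add (h.dvd_pair hi hj hij) hd)

theorem not_adj_of_type (hi : HasType G a b c x y z i) (hj : HasType G a b c x' y' z' j)
    (hij : i ≠ j) (hd : (d : ℤ) ∣ y * x' + y' * z + G.degree b * x' * z) : ¬ G.Adj i j :=
  h.adj_eq_zero_of_dvd (by simpa using dvd_add (h.dvd_pair hi hj hij) hd)

/-- Here the vertices of type `(0, 1, 0)` are twins of `a` and `c`, and those of type `(1, 0, 1)` are
twins of `b`.  All other vertices are adjacent to everything, so the missing edges are those
inside two disjoint sets. -/
theorem not_adj_iff_of_twins (hU : ∀ v, ¬ HasType G a b c 1 1 0 v)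
    (hW : ∀ v, ¬ HasType G a b c 0 1 1 v)
    (hQQ : ∀ u v, HasType G a b c 1 0 1 u → HasType G a b c 1 0 1 v → u ≠ v → ¬ G.Adj u v)
    (hQR : ∀ u v, HasType G a b c 1 0 1 u → HasType G a b c 1 1 1 v → u ≠ v → G.Adj u v)
    (hRR : ∀ u v, HasType G a b c 1 1 1 u → HasType G a b c 1 1 1 v → u ≠ v → G.Adj u v)
    (u v : V) (huv : u ≠ v) :
    ¬ G.Adj u v ↔
      (u ∈ insert a (insert c (cell G a b c 0 1 0)) ∧
        v ∈ insert a (insert c (cell G a b c 0 1 0))) ∨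
      (u ∈ insert b (cell G a b c 1 0 1) ∧ v ∈ insert b (cell G a b c 1 0 1)) := by
  have hPP : ∀ u v, HasType G a b c 0 1 0 u → HasType G a b c 0 1 0 v → u ≠ v → ¬ G.Adj u v :=
    fun u v hu hv huv => h.not_adj_of_type hu hv huv (by simp)
  have hPQ : ∀ u v, HasType G a b c 0 1 0 u → HasType G a b c 1 0 1 v → u ≠ v → G.Adj u v :=
    fun u v hu hv huv => h.adj_of_type hu hv huv (by simp)
  have hPR : ∀ u v, HasType G a b c 0 1 0 u → HasType G a b c 1 1 1 v → u ≠ v → G.Adj u v :=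
    fun u v hu hv huv => h.adj_of_type hu hv huv (by simp)
  have hP : ∀ v, HasType G a b c 0 1 0 v ↔
      v ≠ a ∧ v ≠ b ∧ v ≠ c ∧ ¬ G.Adj v a ∧ G.Adj v b ∧ ¬ G.Adj v c := by
    simp [HasType, adj_eq_zero, adj_eq_one]
  have hQ : ∀ v, HasType G a b c 1 0 1 v ↔
      v ≠ a ∧ v ≠ b ∧ v ≠ c ∧ G.Adj v a ∧ ¬ G.Adj v b ∧ G.Adj v c := by
    simp [HasType, adj_eq_zero, adj_eq_one]
  have hR : ∀ v, HasType G a b c 1 1 1 v ↔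
      v ≠ a ∧ v ≠ b ∧ v ≠ c ∧ G.Adj v a ∧ G.Adj v b ∧ G.Adj v c := by
    simp [HasType, adj_eq_one]
  have hcov := h.type_cases
  have hac := h.not_adj_ac
  have hab := h.adj_ab
  have hbc := h.adj_bc
  have hne := h.ne_ac
  have hsymm : ∀ x y, G.Adj x y → G.Adj y x := fun x y h => h.symm
  simp only [Finset.mem_insert, mem_cell]
  clear h
  grind

end PathModulus

theorem not_hasType_of_card {a b c : V} {x y z : ℤ} (hc : (cell G a b c x y z).card = 0)
    (v : V) : ¬ HasType G a b c x y z v := by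
  rw [← mem_cell, Finset.card_eq_zero.mp hc]
  simp

theorem exists_hasType_of_card {a b c : V} {x y z : ℤ} (hc : 1 ≤ (cell G a b c x y z).card) :
    ∃ v, HasType G a b c x y z v := by
  obtain ⟨v, hv⟩ := Finset.card_pos.mp hc
  exact ⟨v, mem_cell.mp hv⟩

theorem eq_of_card_le_one {a b c : V} {x y z : ℤ} (hc : (cell G a b c x y z).card ≤ 1)
    {u v : V} (hu : HasType G a b c x y z u) (hv : HasType G a b c x y z v) : u = v :=
  Finset.card_le_one.mp hc u (mem_cell.mpr hu) v (mem_cell.mpr hv)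

namespace PathModulus

variable {d : ℕ} {a b c : V} (h : PathModulus G d a b c)

include h

/-- The case in which the vertices adjacent to the whole path form a second independent set. -/
theorem not_adj_iff_of_star (hQ : ∀ v, ¬ HasType G a b c 1 0 1 v)
    (hU : ∀ v, ¬ HasType G a b c 1 1 0 v) (hW : ∀ v, ¬ HasType G a b c 0 1 1 v)
    (hRR : ∀ u v, HasType G a b c 1 1 1 u → HasType G a b c 1 1 1 v → u ≠ v → ¬ G.Adj u v)
    (u v : V) (huv : u ≠ v) :
    ¬ G.Adj u v ↔
      (u ∈ insert a (insert c (cell G a b c 0 1 0)) ∧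
        v ∈ insert a (insert c (cell G a b c 0 1 0))) ∨
      (u ∈ cell G a b c 1 1 1 ∧ v ∈ cell G a b c 1 1 1) := by
  have hPP : ∀ u v, HasType G a b c 0 1 0 u → HasType G a b c 0 1 0 v → u ≠ v → ¬ G.Adj u v :=
    fun u v hu hv huv => h.not_adj_of_type hu hv huv (by simp)
  have hPR : ∀ u v, HasType G a b c 0 1 0 u → HasType G a b c 1 1 1 v → u ≠ v → G.Adj u v :=
    fun u v hu hv huv => h.adj_of_type hu hv huv (by simp)
  have hP : ∀ v, HasType G a b c 0 1 0 v ↔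
      v ≠ a ∧ v ≠ b ∧ v ≠ c ∧ ¬ G.Adj v a ∧ G.Adj v b ∧ ¬ G.Adj v c := by
    simp [HasType, adj_eq_zero, adj_eq_one]
  have hR : ∀ v, HasType G a b c 1 1 1 v ↔
      v ≠ a ∧ v ≠ b ∧ v ≠ c ∧ G.Adj v a ∧ G.Adj v b ∧ G.Adj v c := by
    simp [HasType, adj_eq_one]
  have hcov := h.type_cases
  have hac := h.not_adj_ac
  have hab := h.adj_ab
  have hbc := h.adj_bc
  have hne := h.ne_ac
  have hsymm : ∀ x y, G.Adj x y → G.Adj y x := fun x y h => h.symm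
  simp only [Finset.mem_insert, mem_cell]
  clear h
  grind

/-- Vertices adjacent to one end and the middle form, with that end, a clique on each side, and there
are no edges between the two sides. -/
theorem not_adj_iff_of_two_cliques (hP : ∀ v, ¬ HasType G a b c 0 1 0 v)
    (hQ : ∀ v, ¬ HasType G a b c 1 0 1 v) (hR : ∀ v, ¬ HasType G a b c 1 1 1 v)
    (u v : V) (huv : u ≠ v) :
    ¬ G.Adj u v ↔
      (u ∈ insert a (cell G a b c 1 1 0) ∧ v ∈ insert c (cell G a b c 0 1 1)) ∨
      (u ∈ insert c (cell G a b c 0 1 1) ∧ v ∈ insert a (cell G a b c 1 1 0)) := by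
  have hUU : ∀ u v, HasType G a b c 1 1 0 u → HasType G a b c 1 1 0 v → u ≠ v → G.Adj u v :=
    fun u v hu hv huv => h.adj_of_type hu hv huv (by simp)
  have hWW : ∀ u v, HasType G a b c 0 1 1 u → HasType G a b c 0 1 1 v → u ≠ v → G.Adj u v :=
    fun u v hu hv huv => h.adj_of_type hu hv huv (by simp)
  have hUW : ∀ u v, HasType G a b c 1 1 0 u → HasType G a b c 0 1 1 v → u ≠ v → ¬ G.Adj u v :=
    fun u v hu hv huv => h.not_adj_of_type hu hv huv (by simp)
  have hU : ∀ v, HasType G a b c 1 1 0 v ↔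
      v ≠ a ∧ v ≠ b ∧ v ≠ c ∧ G.Adj v a ∧ G.Adj v b ∧ ¬ G.Adj v c := by
    simp [HasType, adj_eq_zero, adj_eq_one]
  have hW : ∀ v, HasType G a b c 0 1 1 v ↔
      v ≠ a ∧ v ≠ b ∧ v ≠ c ∧ ¬ G.Adj v a ∧ G.Adj v b ∧ G.Adj v c := by
    simp [HasType, adj_eq_zero, adj_eq_one]
  have hcov := h.type_cases
  have hac := h.not_adj_ac
  have hab := h.adj_ab
  have hbc := h.adj_bc
  have hne := h.ne_ac
  have hsymm : ∀ x y, G.Adj x y → G.Adj y x := fun x y h => h.symm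
  simp only [Finset.mem_insert, mem_cell]
  clear h
  grind

theorem card_twins_left : (insert a (insert c (cell G a b c 0 1 0))).card =
    (cell G a b c 0 1 0).card + 2 := by
  rw [Finset.card_insert_of_notMem, Finset.card_insert_of_notMem]
  · simp [mem_cell, HasType]
  · simp [mem_cell, HasType, h.ne_ac]

theorem disjoint_twins : Disjoint (insert a (insert c (cell G a b c 0 1 0)))
    (insert b (cell G a b c 1 0 1)) := by
  rw [Finset.disjoint_left]
  intro v
  have := h.ne_ab
  have := h.ne_bc
  simp only [Finset.mem_insert, mem_cell, HasType]
  grind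

omit h in
theorem disjoint_star : Disjoint (insert a (insert c (cell G a b c 0 1 0)))
    (cell G a b c 1 1 1) := by
  rw [Finset.disjoint_left]
  intro v
  simp only [Finset.mem_insert, mem_cell, HasType]
  grind

theorem disjoint_cliques : Disjoint (insert a (cell G a b c 1 1 0))
    (insert c (cell G a b c 0 1 1)) := by
  rw [Finset.disjoint_left]
  intro v
  have := h.ne_ac
  simp only [Finset.mem_insert, mem_cell, HasType]
  grind

theorem not_left_of_middle {i j : V} (hi : HasType G a b c 0 1 0 i)
    (hj : HasType G a b c 1 1 0 j) : False := by
  have h1 := h.dvd_left hi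
  have h2 := h.dvd_left hj
  have := dvd_sub h2 h1
  exact h.not_dvd_one (Or.inl (by ring)) this

theorem not_left_of_full {i j : V} (hi : HasType G a b c 1 1 1 i)
    (hj : HasType G a b c 1 1 0 j) : False := by
  have h1 := h.dvd_right hi
  have h2 := h.dvd_right hj
  have := dvd_sub h1 h2
  exact h.not_dvd_one (Or.inl (by ring)) this

/-- A vertex adjacent to `a` and `b` only excludes the types `(0, 1, 0)` and `(1, 1, 1)`. -/
theorem card_eq_zero_of_left (hU : 1 ≤ (cell G a b c 1 1 0).card) :
    (cell G a b c 0 1 0).card = 0 ∧ (cell G a b c 1 1 1).card = 0 := by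
  obtain ⟨j, hj⟩ := exists_hasType_of_card hU
  constructor
  · by_contra hne
    obtain ⟨i, hi⟩ := exists_hasType_of_card (Nat.one_le_iff_ne_zero.mpr hne)
    exact h.not_left_of_middle hi hj
  · by_contra hne
    obtain ⟨i, hi⟩ := exists_hasType_of_card (Nat.one_le_iff_ne_zero.mpr hne)
    exact h.not_left_of_full hi hj

omit h in
theorem cell_swap (x y z : ℤ) : cell G c b a z y x = cell G a b c x y z := by
  ext v
  simp only [mem_cell, HasType]
  tauto

end PathModulus

end Classification

/-! ### Classification for large divisors -/

section Classification

/-- `G` is one of the extremal graphs on `n` vertices, and `d` is as large as that graph allows: a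
divisor of `n` for `K_n - e`, a divisor of `n - 1` for `v · K_{n-1}`, and a fixed number for each
of the sporadic graphs. -/
def Extremal {V : Type*} (G : SimpleGraph V) (n d : ℕ) : Prop :=
  (IsCompleteMinus G n (⊤ : SimpleGraph (Fin 2)) ∧ d ∣ n) ∨
  (IsPendantComplete G (n - 1) ∧ d ∣ n - 1) ∨
  (n = 5 ∧ d = 3 ∧
    (IsCompleteMinus G 5 ((⊤ : SimpleGraph (Fin 2)) ⊕g (⊤ : SimpleGraph (Fin 2))) ∨
      IsCompleteMinus G 5 (SimpleGraph.cycleGraph 4))) ∨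
  (n = d + 3 ∧
    (Nonempty (G ≃g completeBipartiteGraph (Fin 2) (Fin 3)) ∨
      IsCompleteMinus G 5 (SimpleGraph.cycleGraph 3) ∨
      IsCompleteMinus G 6 (SimpleGraph.cycleGraph 3) ∨
      IsCompleteMinus G 7 (SimpleGraph.cycleGraph 3 ⊕g SimpleGraph.cycleGraph 3) ∨
      Nonempty (G ≃g completeBipartiteGraph (Fin 3) (Fin 3)) ∨
      IsCompleteMinus G 7 (completeBipartiteGraph (Fin 3) (Fin 3))))

/-- The four-cycle is the complete bipartite graph `K_{2,2}`. -/
def completeBipartiteIsoCycle :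
    completeBipartiteGraph (Fin 2) (Fin 2) ≃g SimpleGraph.cycleGraph 4 where
  toFun := Sum.elim ![0, 2] ![1, 3]
  invFun := ![.inl 0, .inr 0, .inl 1, .inr 1]
  left_inv := by decide
  right_inv := by decide
  map_rel_iff' := by
    rintro (i | i) (j | j) <;> revert i j <;> simp [completeBipartiteGraph] <;> decide

variable {V : Type*} [Fintype V] [DecidableEq V] {G : SimpleGraph V} [DecidableRel G.Adj]

namespace PathModulus

variable {n d : ℕ} {a b c : V} (h : PathModulus G d a b c) (hn : Fintype.card V = n)

include h hn

omit hn in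
/-- The two alternatives are that a vertex of type `(1, 0, 1)` and one of type `(1, 1, 1)` are not
adjacent, or that they are. -/
theorem dvd_or_dvd_ends_full (hQ : 1 ≤ (cell G a b c 1 0 1).card)
    (hR : 1 ≤ (cell G a b c 1 1 1).card) :
    (d : ℤ) ∣ 1 + G.degree b ∨ (d : ℤ) ∣ G.degree b := by
  obtain ⟨i, hi⟩ := exists_hasType_of_card hQ
  obtain ⟨j, hj⟩ := exists_hasType_of_card hR
  have hij : i ≠ j := by
    rintro rfl
    have := hi.2.2.2.2.1.symm.trans hj.2.2.2.2.1
    norm_num at this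
  have hp := h.dvd_or_dvd_of_type hi hj hij
  simpa using hp

/-- A vertex adjacent to `b` only makes `d` a divisor of `deg a`, which is at most `n - 3` when
such a vertex exists; this leaves six possible distributions of types. -/
theorem solution_of_middle (hd : n ≤ d + 3) (hP : 1 ≤ (cell G a b c 0 1 0).card) :
    (cell G a b c 1 1 0).card = 0 ∧ (cell G a b c 0 1 1).card = 0 ∧
    (cell G a b c 0 1 0).card = 1 ∧
    d = 1 + (cell G a b c 1 0 1).card + (cell G a b c 1 1 1).card ∧
    (((cell G a b c 1 0 1).card = 2 ∧ (cell G a b c 1 1 1).card = 0) ∨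
      ((cell G a b c 1 0 1).card = 2 ∧ (cell G a b c 1 1 1).card = 1) ∨
      ((cell G a b c 1 0 1).card = 1 ∧ (cell G a b c 1 1 1).card = 0) ∨
      ((cell G a b c 1 0 1).card = 0 ∧ (cell G a b c 1 1 1).card = 1) ∨
      ((cell G a b c 1 0 1).card = 0 ∧ (cell G a b c 1 1 1).card = 2) ∨
      ((cell G a b c 1 0 1).card = 0 ∧ (cell G a b c 1 1 1).card = 3)) := by
  have hU : (cell G a b c 1 1 0).card = 0 := by
    by_contra hne
    have := (h.card_eq_zero_of_left (Nat.one_le_iff_ne_zero.mpr hne)).1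
    omega
  have hW : (cell G a b c 0 1 1).card = 0 := by
    by_contra hne
    have := (h.symm.card_eq_zero_of_left (by rw [cell_swap]; omega)).1
    rw [cell_swap] at this
    omega
  have hcard := h.card_eq
  have hα := h.degree_left
  have hβ := h.degree_middle
  rw [hn, hU, hW] at hcard
  rw [hU] at hα
  rw [hU, hW] at hβ
  obtain ⟨i, hi⟩ := exists_hasType_of_card hP
  have hdα := h.dvd_left hi
  have hqq := h.dvd_or_dvd_of_two_le_card (x := 1) (y := 0) (z := 1)
  have hrr := h.dvd_or_dvd_of_two_le_card (x := 1) (y := 1) (z := 1)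
  have hqr := h.dvd_or_dvd_ends_full
  rw [hα] at hdα
  rw [hβ] at hqq hrr hqr
  have h2 := h.two_le
  generalize (cell G a b c 0 1 0).card = p at *
  generalize (cell G a b c 1 0 1).card = q at *
  generalize (cell G a b c 1 1 1).card = r at *
  have := solve_middle_type (p := p) (q := q) (r := r) (d := d)
    (by omega) (by omega) (by omega) (by omega) (by omega)
    (by simpa using hdα)
    (fun hc => (hqq (by omega)).imp (fun h => by convert! h using 1; ring)
      (fun h => by convert! h using 1; ring))
    (fun hc hc' => (hqr (by omega) (by omega)).imp (fun h => by convert! h using 1; ring)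
      (fun h => by convert! h using 1))
    (fun hc => (hrr (by omega)).imp (fun h => by convert! h using 1; ring)
      (fun h => by convert! h using 1; ring))
  omega

omit hn in
/-- If all vertices are twins of a vertex of the path, the graph is complete bipartite. -/
theorem adj_iff_of_twins (hU : ∀ v, ¬ HasType G a b c 1 1 0 v)
    (hW : ∀ v, ¬ HasType G a b c 0 1 1 v) (hR : ∀ v, ¬ HasType G a b c 1 1 1 v)
    (hQQ : ∀ u v, HasType G a b c 1 0 1 u → HasType G a b c 1 0 1 v → u ≠ v → ¬ G.Adj u v) :
    (∀ v, v ∈ insert b (cell G a b c 1 0 1) ∨ v ∈ insert a (insert c (cell G a b c 0 1 0))) ∧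
    ∀ u v, u ≠ v → (G.Adj u v ↔
      (u ∈ insert b (cell G a b c 1 0 1) ∧ v ∈ insert a (insert c (cell G a b c 0 1 0))) ∨
      (u ∈ insert a (insert c (cell G a b c 0 1 0)) ∧ v ∈ insert b (cell G a b c 1 0 1))) := by
  have hcov : ∀ v, v ∈ insert b (cell G a b c 1 0 1) ∨
      v ∈ insert a (insert c (cell G a b c 0 1 0)) := by
    intro v
    have hv := h.type_cases v
    simp only [hU, hW, hR, or_false] at hv
    simp only [Finset.mem_insert, mem_cell]
    tauto
  refine ⟨hcov, fun u v huv => ?_⟩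
  have ht := h.not_adj_iff_of_twins hU hW hQQ (fun u v _ hv => absurd hv (hR v))
    (fun u v _ hv => absurd hv (hR v)) u v huv
  have hu := hcov u
  have hv := hcov v
  have hdisj := Finset.disjoint_left.mp h.disjoint_twins
  have hdu := @hdisj u
  have hdv := @hdisj v
  tauto

omit hn in
theorem isCompleteMinus_of_no_twin {m : ℕ} (hm : Fintype.card V = m)
    (hQ : ∀ v, ¬ HasType G a b c 1 0 1 v)
    (hU : ∀ v, ¬ HasType G a b c 1 1 0 v) (hW : ∀ v, ¬ HasType G a b c 0 1 1 v)
    (hRR : ∀ u v, HasType G a b c 1 1 1 u → HasType G a b c 1 1 1 v → u ≠ v → G.Adj u v) {k : ℕ}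
    (hk : (cell G a b c 0 1 0).card + 2 = k) :
    IsCompleteMinus G m (⊤ : SimpleGraph (Fin k)) := by
  refine isCompleteMinus_top hm (insert a (insert c (cell G a b c 0 1 0)))
    (by rw [h.card_twins_left, hk]) fun u v huv => ?_
  rw [h.not_adj_iff_of_twins hU hW (fun u _ hu => absurd hu (hQ u))
    (fun u _ hu => absurd hu (hQ u)) hRR u v huv, or_iff_left]
  simp only [Finset.mem_insert, mem_cell, hQ, or_false]
  rintro ⟨rfl, rfl⟩
  exact huv rfl

/-- When some vertex is adjacent to the middle of the path only. -/
theorem extremal_of_middle (hd : n ≤ d + 3) (hP : 1 ≤ (cell G a b c 0 1 0).card) :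
    Extremal G n d := by
  obtain ⟨hU, hW, hp, hdq, hcases⟩ := h.solution_of_middle hn hd hP
  have hcard := h.card_eq
  have hβ := h.degree_middle
  rw [hn, hU, hW, hp] at hcard
  rw [hU, hW, hp] at hβ
  have hU' := not_hasType_of_card hU
  have hW' := not_hasType_of_card hW
  have hS := h.card_twins_left
  have hT : (insert b (cell G a b c 1 0 1)).card = (cell G a b c 1 0 1).card + 1 :=
    Finset.card_insert_of_notMem (by simp [mem_cell, HasType])
  have hnd : n = d + 3 := by omega
  refine Or.inr (Or.inr (Or.inr ⟨hnd, ?_⟩))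
  rw [SimpleGraph.cycleGraph_three_eq_top]
  rcases hcases with ⟨hq, hr⟩ | ⟨hq, hr⟩ | ⟨hq, hr⟩ | ⟨hq, hr⟩ | ⟨hq, hr⟩ | ⟨hq, hr⟩ <;>
    rw [hr] at hβ <;> rw [hq, hr] at hdq <;> norm_num at hdq hβ <;> subst hdq
  · refine Or.inr (Or.inr (Or.inr (Or.inr (Or.inl ?_))))
    have hb := h.adj_iff_of_twins hU' hW' (not_hasType_of_card hr)
      (fun u v hu hv huv => h.not_adj_of_type hu hv huv (by rw [hβ]; norm_num))
    exact nonempty_iso_completeBipartite _ _ h.disjoint_twins.symm hb.1 (by omega) (by omega) hb.2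
  · refine Or.inr (Or.inr (Or.inr (Or.inl ?_)))
    exact isCompleteMinus_top_sum_top (by omega) _ _ h.disjoint_twins (by omega) (by omega)
      (h.not_adj_iff_of_twins hU' hW'
        (fun u v hu hv huv => h.not_adj_of_type hu hv huv (by rw [hβ]; norm_num))
        (fun u v hu hv huv => h.adj_of_type hu hv huv (by rw [hβ]; norm_num))
        (fun u v hu hv huv => absurd (eq_of_card_le_one (by omega) hu hv) huv))
  · refine Or.inl ?_
    have hb := h.adj_iff_of_twins hU' hW' (not_hasType_of_card hr)
      (fun u v hu hv huv => absurd (eq_of_card_le_one (by omega) hu hv) huv)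
    exact nonempty_iso_completeBipartite _ _ h.disjoint_twins.symm hb.1 (by omega) (by omega) hb.2
  · refine Or.inr (Or.inl ?_)
    exact h.isCompleteMinus_of_no_twin (by omega) (not_hasType_of_card hq) hU' hW'
      (fun u v hu hv huv => absurd (eq_of_card_le_one (by omega) hu hv) huv) (by omega)
  · refine Or.inr (Or.inr (Or.inl ?_))
    exact h.isCompleteMinus_of_no_twin (by omega) (not_hasType_of_card hq) hU' hW'
      (fun u v hu hv huv => h.adj_of_type hu hv huv (by rw [hβ]; norm_num)) (by omega)
  · refine Or.inr (Or.inr (Or.inr (Or.inl ?_)))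
    exact isCompleteMinus_top_sum_top (by omega) _ _ disjoint_star (by omega) (by omega)
      (h.not_adj_iff_of_star (not_hasType_of_card hq) hU' hW'
        (fun u v hu hv huv => h.not_adj_of_type hu hv huv (by rw [hβ]; norm_num)))

/-- When some vertex is adjacent to both ends of the path but not to its middle, and no other types
occur except vertices adjacent to the whole path. -/
theorem extremal_of_ends (hn5 : 5 ≤ n) (hd : n ≤ d + 3) (hP : (cell G a b c 0 1 0).card = 0)
    (hQ : 1 ≤ (cell G a b c 1 0 1).card)
    (hU : (cell G a b c 1 1 0).card = 0) (hW : (cell G a b c 0 1 1).card = 0) :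
    Extremal G n d := by
  have hcard := h.card_eq
  have hα := h.degree_left
  have hβ := h.degree_middle
  have hγ := h.degree_right
  rw [hn, hP, hU, hW] at hcard
  rw [hU] at hα
  rw [hW] at hγ
  rw [hP, hU, hW] at hβ
  have hends := h.dvd_ends
  obtain ⟨i, hi⟩ := exists_hasType_of_card hQ
  have hdα := h.dvd_left hi
  have hqq := h.dvd_or_dvd_of_two_le_card (x := 1) (y := 0) (z := 1)
  have hrr := h.dvd_or_dvd_of_two_le_card (x := 1) (y := 1) (z := 1)
  have hqr := h.dvd_or_dvd_ends_full hQ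
  have hU' := not_hasType_of_card hU
  have hW' := not_hasType_of_card hW
  have hS := h.card_twins_left
  have hT : (insert b (cell G a b c 1 0 1)).card = (cell G a b c 1 0 1).card + 1 :=
    Finset.card_insert_of_notMem (by simp [mem_cell, HasType])
  -- `d` divides `deg a * deg b`, so the nonlinear term of the relation between the ends drops out.
  have hends' : (d : ℤ) ∣ G.degree a + G.degree c := by
    have := dvd_add hends (hdα.mul_right (G.degree c : ℤ))
    ring_nf at this
    convert! this using 1
  rw [hα, hγ] at hends'
  rw [hα] at hdα
  have hsol := solve_ends_type (q := (cell G a b c 1 0 1).card) (r := (cell G a b c 1 1 1).card)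
    (d := d) (by omega) (by omega) (by omega) (by omega)
    (by rw [hβ] at hdα; convert! hdα using 1; push_cast; ring)
    (by convert! hends' using 1; push_cast; ring)
    (fun hc => (hqq (by omega)).imp (fun h => by rw [hβ] at h; convert! h using 1; ring)
      (fun h => by rw [hβ] at h; convert! h using 1; ring))
    (fun hc => (hqr (by omega)).imp (fun h => by rw [hβ] at h; convert! h using 1; ring)
      (fun h => by rw [hβ] at h; convert! h using 1))
    (fun hc => (hrr (by omega)).imp (fun h => by rw [hβ] at h; convert! h using 1; ring)
      (fun h => by rw [hβ] at h; convert! h using 1; ring))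
  rcases hsol with ⟨hq, hr, hd'⟩ | ⟨hq, hr, hd'⟩ <;> rw [hr] at hβ <;> norm_num at hβ
  · obtain rfl : d = 3 := by omega
    obtain rfl : n = 5 := by omega
    refine Or.inr (Or.inr (Or.inl ⟨rfl, rfl, Or.inl ?_⟩))
    exact isCompleteMinus_top_sum_top (by omega) _ _ h.disjoint_twins (by omega) (by omega)
      (h.not_adj_iff_of_twins hU' hW'
        (fun u v hu hv huv => absurd (eq_of_card_le_one (by omega) hu hv) huv)
        (fun u v hu hv huv => h.adj_of_type hu hv huv (by rw [hβ]; norm_num))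
        (fun u v hu hv huv => absurd (eq_of_card_le_one (by omega) hu hv) huv))
  · obtain rfl : d = 2 := by omega
    obtain rfl : n = 5 := by omega
    refine Or.inr (Or.inr (Or.inr ⟨rfl, Or.inl ?_⟩))
    have hb := h.adj_iff_of_twins hU' hW' (not_hasType_of_card (by omega))
      (fun u v hu hv huv => h.not_adj_of_type hu hv huv (by rw [hβ]; norm_num))
    exact nonempty_iso_completeBipartite _ _ h.disjoint_twins (fun v => (hb.1 v).symm)
      (by omega) (by omega) (fun u v huv => (hb.2 u v huv).trans Or.comm)

/-- When every vertex outside the path is adjacent to all of it. -/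
theorem extremal_of_full (hn5 : 5 ≤ n) (hd : n ≤ d + 3) (hP : (cell G a b c 0 1 0).card = 0)
    (hQ : (cell G a b c 1 0 1).card = 0)
    (hU : (cell G a b c 1 1 0).card = 0) (hW : (cell G a b c 0 1 1).card = 0) :
    Extremal G n d := by
  have hcard := h.card_eq
  have hα := h.degree_left
  have hβ := h.degree_middle
  rw [hn, hP, hQ, hU, hW] at hcard
  rw [hQ, hU] at hα
  rw [hP, hU, hW] at hβ
  have hQ' := not_hasType_of_card hQ
  have hU' := not_hasType_of_card hU
  have hW' := not_hasType_of_card hW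
  obtain ⟨i, hi⟩ := exists_hasType_of_card (G := G) (a := a) (b := b) (c := c) (x := 1) (y := 1)
    (z := 1) (by omega)
  have hdα := h.dvd_left hi
  have hrr := h.dvd_or_dvd_of_two_le_card (x := 1) (y := 1) (z := 1) (by omega)
  have hS := h.card_twins_left
  rw [hα] at hdα
  have hsol := solve_full_type (r := (cell G a b c 1 1 1).card) (d := d) (by omega) (by omega)
    (by rw [hβ] at hdα; convert! hdα using 1; push_cast; ring)
    (hrr.imp (fun h => by rw [hβ] at h; convert! h using 1; ring)
      (fun h => by rw [hβ] at h; convert! h using 1; ring))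
  have hdn : (d : ℤ) ∣ 3 + (cell G a b c 1 1 1).card → Extremal G n d := by
    intro hdn
    refine Or.inl ⟨h.isCompleteMinus_of_no_twin hn hQ' hU' hW'
      (fun u v hu hv huv => h.adj_of_type hu hv huv ?_) (by omega), ?_⟩
    · rw [hβ]
      convert! hdn using 1
      push_cast
      ring
    · rw [← Int.natCast_dvd_natCast, hcard]
      convert! hdn using 1
  rcases hsol with hsol | ⟨hr, hd3⟩
  · exact hdn hsol
  · obtain rfl : d = 3 := by omega
    obtain rfl : n = 5 := by omega
    rw [hr] at hβ
    norm_num at hβ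
    refine Or.inr (Or.inr (Or.inl ⟨rfl, rfl, Or.inl ?_⟩))
    exact isCompleteMinus_top_sum_top hn _ _ disjoint_star (by omega) (by omega)
      (h.not_adj_iff_of_star hQ' hU' hW'
        (fun u v hu hv huv => h.not_adj_of_type hu hv huv (by rw [hβ]; norm_num)))

end PathModulus

namespace PathModulus

variable {n d : ℕ} {a b c : V} (h : PathModulus G d a b c) (hn : Fintype.card V = n)

include h

theorem dvd_degree_of_left_ends {i j : V} (hi : HasType G a b c 1 1 0 i)
    (hj : HasType G a b c 1 0 1 j) : (d : ℤ) ∣ G.degree b := by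
  have hij : i ≠ j := by
    rintro rfl
    have := hi.2.2.2.2.1.symm.trans hj.2.2.2.2.1
    norm_num at this
  have h1 := h.dvd_pair hi hj hij
  have h2 := h.dvd_pair hj hi hij.symm
  rw [adj_comm] at h2
  have := dvd_sub h1 h2
  ring_nf at this
  exact this

theorem dvd_degree_of_left_right {i j : V} (hi : HasType G a b c 1 1 0 i)
    (hj : HasType G a b c 0 1 1 j) : (d : ℤ) ∣ 2 + G.degree b := by
  have hij : i ≠ j := by
    rintro rfl
    have := hi.2.2.2.1.symm.trans hj.2.2.2.1
    norm_num at this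
  have h1 := h.dvd_pair hi hj hij
  have h2 := h.dvd_pair hj hi hij.symm
  rw [adj_comm] at h2
  have := dvd_sub h1 h2
  ring_nf at this
  convert! this using 1

include hn

theorem isPendantComplete_of_left (hP : (cell G a b c 0 1 0).card = 0)
    (hQ : (cell G a b c 1 0 1).card = 0) (hR : (cell G a b c 1 1 1).card = 0)
    (hW : (cell G a b c 0 1 1).card = 0) : IsPendantComplete G (n - 1) := by
  have hpos : 0 < n := hn ▸ Fintype.card_pos_iff.mpr ⟨a⟩
  refine isPendantComplete_of (by omega) b c h.ne_bc fun u v huv => ?_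
  have ha := h.not_adj_iff_of_two_cliques (not_hasType_of_card hP) (not_hasType_of_card hQ)
    (not_hasType_of_card hR) u v huv
  have hcov : ∀ v, v ∈ insert a (cell G a b c 1 1 0) ↔ v ≠ b ∧ v ≠ c := by
    intro v
    have hv := h.type_cases v
    simp only [not_hasType_of_card hP, not_hasType_of_card hQ, not_hasType_of_card hR,
      not_hasType_of_card hW, or_false, false_or] at hv
    have := h.ne_ab
    have := h.ne_ac
    simp only [Finset.mem_insert, mem_cell]
    constructor
    · rintro (rfl | hv)
      · exact ⟨h.ne_ab, h.ne_ac⟩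
      · exact ⟨hv.2.1, hv.2.2.1⟩
    · tauto
  rw [hcov, hcov, Finset.card_eq_zero.mp hW] at ha
  simp only [insert_empty_eq, Finset.mem_singleton] at ha
  have := h.ne_bc
  grind

/-- When some vertex is adjacent to `a` and `b` only: the graph is a pendant complete graph, or two
cliques that share the vertex `b`. -/
theorem extremal_of_left (hd : n ≤ d + 3) (hU : 1 ≤ (cell G a b c 1 1 0).card) :
    Extremal G n d := by
  obtain ⟨hP, hR⟩ := h.card_eq_zero_of_left hU
  have hcard := h.card_eq
  have hα := h.degree_left
  have hβ := h.degree_middle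
  have hγ := h.degree_right
  rw [hn, hP, hR] at hcard
  rw [hR] at hα hγ
  rw [hP, hR] at hβ
  obtain ⟨i, hi⟩ := exists_hasType_of_card hU
  have hdα := h.dvd_left hi
  rw [hα] at hdα
  have hQU : 1 ≤ (cell G a b c 1 0 1).card → (d : ℤ) ∣ G.degree b := by
    intro hQ
    obtain ⟨j, hj⟩ := exists_hasType_of_card hQ
    exact h.dvd_degree_of_left_ends hi hj
  rw [hβ] at hQU
  have hdα' : (d : ℤ) ∣ 2 + (cell G a b c 1 0 1).card + (cell G a b c 1 1 0).card := by
    convert! hdα using 1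
    push_cast
    ring
  by_cases hW : (cell G a b c 0 1 1).card = 0
  · obtain ⟨hq, hdn⟩ := solve_one_side (q := (cell G a b c 1 0 1).card)
      (u := (cell G a b c 1 1 0).card) (d := d) (by omega) (by omega) (by omega) hdα'
      (fun hq => by rw [hW] at hQU; simpa using hQU (by omega))
    refine Or.inr (Or.inl ⟨h.isPendantComplete_of_left hn hP (by omega) hR hW, ?_⟩)
    rw [← Int.natCast_dvd_natCast]
    convert! hdn using 1
    omega
  · obtain ⟨j, hj⟩ := exists_hasType_of_card (Nat.one_le_iff_ne_zero.mpr hW)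
    have hdγ := h.dvd_right hj
    rw [hγ] at hdγ
    have hUW := h.dvd_degree_of_left_right hi hj
    rw [hβ] at hUW
    obtain ⟨hq, hcases⟩ := solve_two_sides (q := (cell G a b c 1 0 1).card)
      (u := (cell G a b c 1 1 0).card) (w := (cell G a b c 0 1 1).card) (d := d) (by omega)
      (by omega) (by omega) (by omega) hdα'
      (by convert! hdγ using 1; push_cast; ring) (by convert! hUW using 1; push_cast; ring)
      (fun hq => by simpa using hQU (by omega))
    have hS : (insert a (cell G a b c 1 1 0)).card = (cell G a b c 1 1 0).card + 1 :=
      Finset.card_insert_of_notMem (by simp [mem_cell, HasType])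
    have hT : (insert c (cell G a b c 0 1 1)).card = (cell G a b c 0 1 1).card + 1 :=
      Finset.card_insert_of_notMem (by simp [mem_cell, HasType])
    have hadj := h.not_adj_iff_of_two_cliques (not_hasType_of_card hP)
      (not_hasType_of_card (by omega)) (not_hasType_of_card hR)
    rcases hcases with ⟨hu, hw, hd'⟩ | ⟨hu, hw, hd'⟩
    · refine Or.inr (Or.inr (Or.inl ⟨by omega, by omega, Or.inr ?_⟩))
      exact isCompleteMinus_congr (isCompleteMinus_completeBipartite (by omega) _ _
        h.disjoint_cliques (by omega) (by omega) hadj) completeBipartiteIsoCycle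
    · refine Or.inr (Or.inr (Or.inr ⟨by omega, Or.inr (Or.inr (Or.inr (Or.inr (Or.inr ?_))))⟩))
      exact isCompleteMinus_completeBipartite (by omega) _ _ h.disjoint_cliques (by omega)
        (by omega) hadj

theorem extremal (hn5 : 5 ≤ n) (hd : n ≤ d + 3) : Extremal G n d := by
  by_cases hU : (cell G a b c 1 1 0).card = 0
  · by_cases hW : (cell G a b c 0 1 1).card = 0
    · by_cases hP : (cell G a b c 0 1 0).card = 0
      · by_cases hQ : (cell G a b c 1 0 1).card = 0
        · exact h.extremal_of_full hn hn5 hd hP hQ hU hW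
        · exact h.extremal_of_ends hn hn5 hd hP (Nat.one_le_iff_ne_zero.mpr hQ) hU hW
      · exact h.extremal_of_middle hn hd (Nat.one_le_iff_ne_zero.mpr hP)
    · exact h.symm.extremal_of_left hn hd (by rw [cell_swap]; omega)
  · exact h.extremal_of_left hn hd (Nat.one_le_iff_ne_zero.mpr hU)

end PathModulus

/-- Every divisor `d ≥ n - 3` of the third determinantal divisor is accounted for by one of the
extremal graphs, also when the determinantal divisor itself is `0`. -/
theorem extremal_of_dvd {n d : ℕ} (hn : Fintype.card V = n) (hn5 : 5 ≤ n) (hconn : G.Connected)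
    (hne : G ≠ ⊤) (hd : n ≤ d + 3) (hdvd : d ∣ determinantalDivisor (G.lapMatrix ℤ) 3) :
    Extremal G n d := by
  obtain ⟨a, b, c, hab, hbc, hac, hnac⟩ := exists_induced_path hconn hne
  exact PathModulus.extremal ⟨hconn, by omega, hdvd, hab, hbc, hac, hnac⟩ hn hn5 hd

end Classification

/-! ### Divisibility of the minors of the extremal graphs -/

section Converse

instance {V W : Type*} (G : SimpleGraph V) (H : SimpleGraph W) [DecidableRel G.Adj]
    [DecidableRel H.Adj] : DecidableRel (G ⊕g H).Adj
  | .inl u, .inl v => inferInstanceAs (Decidable (G.Adj u v))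
  | .inr u, .inr v => inferInstanceAs (Decidable (H.Adj u v))
  | .inl _, .inr _ => isFalse (by simp)
  | .inr _, .inl _ => isFalse (by simp)

instance {V W : Type*} : DecidableRel (completeBipartiteGraph V W).Adj :=
  fun _ _ => inferInstanceAs (Decidable (_ ∨ _))

variable {V : Type*} [Fintype V] [DecidableEq V] {G : SimpleGraph V} [DecidableRel G.Adj]

theorem dvd_of_isCompleteMinus_edge {n : ℕ} (hn : Fintype.card V = n)
    (h : IsCompleteMinus G n (⊤ : SimpleGraph (Fin 2))) :
    n ∣ determinantalDivisor (G.lapMatrix ℤ) 3 := by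
  obtain ⟨f, ⟨e⟩⟩ := h
  obtain ⟨a, ha⟩ : ∃ a, e a = f 0 := e.surjective _
  obtain ⟨c, hc⟩ : ∃ c, e c = f 1 := e.surjective _
  have hac : a ≠ c := by
    rintro rfl
    have := f.injective (ha.symm.trans hc)
    norm_num at this
  have hadj : ∀ u v, G.Adj u v ↔ u ≠ v ∧ ¬ (u = a ∧ v = c) ∧ ¬ (u = c ∧ v = a) := by
    intro u v
    rw [← e.map_rel_iff, SimpleGraph.sdiff_adj, map_embedding_adj, ← e.injective.eq_iff (a := u),
      ← e.injective.eq_iff (a := v), ← e.injective.eq_iff (a := u) (b := c),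
      ← e.injective.eq_iff (a := v) (b := a), ha, hc]
    simp [Fin.exists_fin_two, eq_comm, e.injective.eq_iff]
  have hval : ∀ u v, adj G u v = 1 - (if v = u then 1 else 0) -
      (if v = c then if u = a then 1 else 0 else 0) -
      (if v = a then if u = c then 1 else 0 else 0) := by
    intro u v
    simp only [adj, hadj]
    grind
  have hdeg : ∀ u, (G.degree u : ℤ) = n - 1 - (if u = a then 1 else 0) -
      (if u = c then 1 else 0) := by
    intro u
    simp [degree_eq_sum_adj, hval, Finset.sum_sub_distrib, hn]
  -- Modulo `n`, the Laplacian matrix is `-J` minus the matrix `x * xᵀ` with `x` the indicator of `a`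
  -- minus that of `c`.
  refine dvd_determinantalDivisor_three _ _ (fun _ => -1) (fun _ => 1)
    (fun u => (if u = c then 1 else 0) - (if u = a then 1 else 0))
    (fun v => (if v = a then 1 else 0) - (if v = c then 1 else 0)) fun i j => ?_
  by_cases hij : i = j
  · subst hij
    rw [lapMatrix_apply_self, hdeg]
    refine dvd_of_eq ?_
    grind
  · rw [lapMatrix_apply_of_ne hij, hval]
    have : -(1 - (if j = i then (1 : ℤ) else 0) - (if j = c then if i = a then 1 else 0 else 0) -
      (if j = a then if i = c then 1 else 0 else 0)) -
      (-1 * 1 + ((if i = c then 1 else 0) - (if i = a then 1 else 0)) *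
        ((if j = a then 1 else 0) - (if j = c then 1 else 0))) = 0 := by
      grind
    rw [this]
    exact dvd_zero _

theorem addPendant_adj {W : Type*} (H : SimpleGraph W) (w : W) (x y : Option W) :
    (addPendant H w).Adj x y ↔ (∃ p q, H.Adj p q ∧ some p = x ∧ some q = y) ∨
      ((x = none ∧ y = some w ∨ x = some w ∧ y = none) ∧ x ≠ y) := by
  rw [addPendant, SimpleGraph.sup_adj, map_embedding_adj, SimpleGraph.edge_adj]
  rfl

theorem dvd_of_isPendantComplete {n : ℕ} (hn : Fintype.card V = n)
    (h : IsPendantComplete G (n - 1)) :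
    n - 1 ∣ determinantalDivisor (G.lapMatrix ℤ) 3 := by
  obtain ⟨w, ⟨e⟩⟩ := h
  obtain ⟨b, hb⟩ : ∃ b, e b = some w := e.surjective _
  obtain ⟨c, hc⟩ : ∃ c, e c = none := e.surjective _
  have hbc : b ≠ c := by
    rintro rfl
    simpa using hb.symm.trans hc
  have hpos : 0 < n := hn ▸ Fintype.card_pos_iff.mpr ⟨b⟩
  have hadj : ∀ u v, G.Adj u v ↔ u ≠ v ∧ (u = c → v = b) ∧ (v = c → u = b) := by
    intro u v
    rw [← e.map_rel_iff, addPendant_adj, ← e.injective.ne_iff (x := u) (y := v),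
      ← e.injective.eq_iff (a := u) (b := c), ← e.injective.eq_iff (a := v) (b := b),
      ← e.injective.eq_iff (a := v) (b := c), ← e.injective.eq_iff (a := u) (b := b), hb, hc]
    rcases e u with _ | x <;> rcases e v with _ | y <;> simp [eq_comm]
  have hval : ∀ u v, adj G u v = if u = c then (if v = b then 1 else 0) else
      1 - (if v = u then 1 else 0) - (if v = c then if u = b then 0 else 1 else 0) := by
    intro u v
    simp only [adj, hadj]
    grind
  have hdeg : ∀ u, (G.degree u : ℤ) = if u = c then 1 else
      (n : ℤ) - 1 - (if u = b then 0 else 1) := by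
    intro u
    by_cases hu : u = c
    · simp [degree_eq_sum_adj, hval, hu]
    · simp [degree_eq_sum_adj, hval, hu, Finset.sum_sub_distrib, hn]
  -- Modulo `n - 1`, the Laplacian matrix is `y * yᵀ - x * xᵀ` with `x` the indicator of the
  -- complement of `c` and `y` the indicator of `b` minus that of `c`.
  refine dvd_determinantalDivisor_three _ _ (fun u => if u = c then 0 else -1)
    (fun v => if v = c then 0 else 1)
    (fun u => (if u = b then 1 else 0) - (if u = c then 1 else 0))
    (fun v => (if v = b then 1 else 0) - (if v = c then 1 else 0)) fun i j => ?_
  have hcast : ((n - 1 : ℕ) : ℤ) = n - 1 := by omega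
  rw [hcast]
  by_cases hij : i = j
  · subst hij
    rw [lapMatrix_apply_self, hdeg]
    by_cases hic : i = c
    · subst hic
      simp [hbc.symm]
    · refine dvd_of_eq ?_
      grind
  · rw [lapMatrix_apply_of_ne hij, hval]
    refine (dvd_zero _).trans (dvd_of_eq ?_)
    grind

/-- Converse of `PathModulus.dvd_lapMatrix`: the congruence writes `M` modulo `d` as a sum of two
rank-one matrices. -/
theorem dvd_determinantalDivisor_of_path (M : Matrix V V ℤ) (d : ℕ) (a b c : V)
    (h : ∀ i j, (d : ℤ) ∣ M i j + M i b * M a j + (M b b * M a j + M b j) * M i c) :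
    d ∣ determinantalDivisor M 3 := by
  refine dvd_determinantalDivisor_three M d (fun i => -M i b) (M a) (fun i => -M i c)
    (fun j => M b b * M a j + M b j) fun i j => ?_
  convert! h i j using 1
  ring

theorem dvd_minor_of_iso {W : Type*} [Fintype W] [DecidableEq W] {H : SimpleGraph W}
    [DecidableRel H.Adj] (e : G ≃g H) (r c : Fin 3 → W) :
    (determinantalDivisor (G.lapMatrix ℤ) 3 : ℤ) ∣ ((H.lapMatrix ℤ).submatrix r c).det := by
  rw [determinantalDivisor_lapMatrix_iso e]
  exact determinantalDivisor_dvd_det _ _ _ _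

/-- The first `k + l` vertices of `Fin m`, split into two blocks. -/
def blocks (k l m : ℕ) (h : k + l ≤ m) : Fin k ⊕ Fin l ↪ Fin m :=
  finSumFinEquiv.toEmbedding.trans (Fin.castLEEmb h)

theorem dvd_of_isCompleteMinus_two_edges
    (h : IsCompleteMinus G 5 ((⊤ : SimpleGraph (Fin 2)) ⊕g (⊤ : SimpleGraph (Fin 2)))) :
    3 ∣ determinantalDivisor (G.lapMatrix ℤ) 3 := by
  obtain ⟨e⟩ := nonempty_iso_of_isCompleteMinus h (blocks 2 2 5 (by norm_num))
  rw [determinantalDivisor_lapMatrix_iso e]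
  apply dvd_determinantalDivisor_of_path _ _ 0 2 1
  decide +kernel

theorem dvd_of_isCompleteMinus_cycle_four
    (h : IsCompleteMinus G 5 (SimpleGraph.cycleGraph 4)) :
    3 ∣ determinantalDivisor (G.lapMatrix ℤ) 3 := by
  obtain ⟨e⟩ := nonempty_iso_of_isCompleteMinus h (Fin.castLEEmb (by norm_num))
  rw [determinantalDivisor_lapMatrix_iso e]
  apply dvd_determinantalDivisor_of_path _ _ 0 4 1
  decide +kernel

theorem dvd_of_iso_completeBipartite_two_three
    (h : Nonempty (G ≃g completeBipartiteGraph (Fin 2) (Fin 3))) :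
    2 ∣ determinantalDivisor (G.lapMatrix ℤ) 3 ∧
      ¬ 4 ∣ determinantalDivisor (G.lapMatrix ℤ) 3 := by
  obtain ⟨e⟩ := h
  constructor
  · rw [determinantalDivisor_lapMatrix_iso e]
    apply dvd_determinantalDivisor_of_path _ _ (.inr 0) (.inl 0) (.inr 1)
    decide +kernel
  · intro hd
    have h2 := (Int.natCast_dvd_natCast.mpr hd).trans
      (dvd_minor_of_iso e ![.inl 0, .inl 1, .inr 0] ![.inl 0, .inl 1, .inr 1])
    rw [Matrix.det_fin_three] at h2
    revert h2
    decide +kernel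

theorem dvd_of_isCompleteMinus_triangle_five
    (h : IsCompleteMinus G 5 (SimpleGraph.cycleGraph 3)) :
    2 ∣ determinantalDivisor (G.lapMatrix ℤ) 3 ∧
      ¬ 4 ∣ determinantalDivisor (G.lapMatrix ℤ) 3 := by
  obtain ⟨e⟩ := nonempty_iso_of_isCompleteMinus h (Fin.castLEEmb (by norm_num))
  constructor
  · rw [determinantalDivisor_lapMatrix_iso e]
    apply dvd_determinantalDivisor_of_path _ _ 0 3 1
    decide +kernel
  · intro hd
    have h2 := (Int.natCast_dvd_natCast.mpr hd).trans
      (dvd_minor_of_iso e ![0, 1, 3] ![0, 2, 3])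
    rw [Matrix.det_fin_three] at h2
    revert h2
    decide +kernel

theorem dvd_of_isCompleteMinus_triangle_six
    (h : IsCompleteMinus G 6 (SimpleGraph.cycleGraph 3)) :
    3 ∣ determinantalDivisor (G.lapMatrix ℤ) 3 ∧
      ¬ 2 ∣ determinantalDivisor (G.lapMatrix ℤ) 3 := by
  obtain ⟨e⟩ := nonempty_iso_of_isCompleteMinus h (Fin.castLEEmb (by norm_num))
  constructor
  · rw [determinantalDivisor_lapMatrix_iso e]
    apply dvd_determinantalDivisor_of_path _ _ 0 3 1
    decide +kernel
  · intro hd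
    have h2 := (Int.natCast_dvd_natCast.mpr hd).trans
      (dvd_minor_of_iso e ![0, 1, 2] ![0, 1, 2])
    rw [Matrix.det_fin_three] at h2
    revert h2
    decide +kernel

theorem dvd_of_isCompleteMinus_two_triangles
    (h : IsCompleteMinus G 7 (SimpleGraph.cycleGraph 3 ⊕g SimpleGraph.cycleGraph 3)) :
    4 ∣ determinantalDivisor (G.lapMatrix ℤ) 3 := by
  obtain ⟨e⟩ := nonempty_iso_of_isCompleteMinus h (blocks 3 3 7 (by norm_num))
  rw [determinantalDivisor_lapMatrix_iso e]
  apply dvd_determinantalDivisor_of_path _ _ 0 6 1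
  decide +kernel

theorem dvd_of_iso_completeBipartite_three_three
    (h : Nonempty (G ≃g completeBipartiteGraph (Fin 3) (Fin 3))) :
    3 ∣ determinantalDivisor (G.lapMatrix ℤ) 3 ∧
      ¬ 2 ∣ determinantalDivisor (G.lapMatrix ℤ) 3 := by
  obtain ⟨e⟩ := h
  constructor
  · rw [determinantalDivisor_lapMatrix_iso e]
    apply dvd_determinantalDivisor_of_path _ _ (.inr 0) (.inl 0) (.inr 1)
    decide +kernel
  · intro hd
    have h2 := (Int.natCast_dvd_natCast.mpr hd).trans
      (dvd_minor_of_iso e ![.inl 0, .inl 1, .inl 2] ![.inl 0, .inl 1, .inl 2])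
    rw [Matrix.det_fin_three] at h2
    revert h2
    decide +kernel

theorem dvd_of_isCompleteMinus_completeBipartite
    (h : IsCompleteMinus G 7 (completeBipartiteGraph (Fin 3) (Fin 3))) :
    4 ∣ determinantalDivisor (G.lapMatrix ℤ) 3 := by
  obtain ⟨e⟩ := nonempty_iso_of_isCompleteMinus h (blocks 3 3 7 (by norm_num))
  rw [determinantalDivisor_lapMatrix_iso e]
  apply dvd_determinantalDivisor_of_path _ _ 0 6 3
  decide +kernel

end Converse

end LaplacianFactor

theorem mainTheorem1 {V : Type*} [Fintype V] [DecidableEq V] (G : SimpleGraph V)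
    [DecidableRel G.Adj] (n : ℕ) (hcard : Fintype.card V = n) (hn : 5 ≤ n)
    (hconn : G.Connected) (hne : G ≠ ⊤) :
    lapInvariantFactor G 3 ≤ n ∧
    (lapInvariantFactor G 3 = n ↔ IsCompleteMinus G n (⊤ : SimpleGraph (Fin 2))) ∧
    (lapInvariantFactor G 3 = n - 1 ↔ IsPendantComplete G (n - 1)) ∧
    (lapInvariantFactor G 3 = n - 2 ↔
      n = 5 ∧
        (IsCompleteMinus G 5 ((⊤ : SimpleGraph (Fin 2)) ⊕g (⊤ : SimpleGraph (Fin 2))) ∨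
          IsCompleteMinus G 5 (SimpleGraph.cycleGraph 4))) ∧
    (lapInvariantFactor G 3 = n - 3 ↔
      Nonempty (G ≃g completeBipartiteGraph (Fin 2) (Fin 3)) ∨
      IsCompleteMinus G 5 (SimpleGraph.cycleGraph 3) ∨
      IsCompleteMinus G 6 (SimpleGraph.cycleGraph 3) ∨
      IsCompleteMinus G 7 (SimpleGraph.cycleGraph 3 ⊕g SimpleGraph.cycleGraph 3) ∨
      Nonempty (G ≃g completeBipartiteGraph (Fin 3) (Fin 3)) ∨
      IsCompleteMinus G 7 (completeBipartiteGraph (Fin 3) (Fin 3))) := by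
  open LaplacianFactor in
  rw [lapInvariantFactor_three_eq hconn hne]
  have hext := fun d => extremal_of_dvd (d := d) hcard hn hconn hne
  have hedge := dvd_of_isCompleteMinus_edge (G := G) hcard
  have hpend := dvd_of_isPendantComplete (G := G) hcard
  have h2e := dvd_of_isCompleteMinus_two_edges (G := G)
  have hc4 := dvd_of_isCompleteMinus_cycle_four (G := G)
  have h23 := dvd_of_iso_completeBipartite_two_three (G := G)
  have ht5 := dvd_of_isCompleteMinus_triangle_five (G := G)
  have ht6 := dvd_of_isCompleteMinus_triangle_six (G := G)
  have h2t := dvd_of_isCompleteMinus_two_triangles (G := G)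
  have h33 := dvd_of_iso_completeBipartite_three_three (G := G)
  have hb := dvd_of_isCompleteMinus_completeBipartite (G := G)
  have hcm : ∀ {m : ℕ} {W : Type} {H : SimpleGraph W}, IsCompleteMinus G m H → n = m := by
    rintro m W H ⟨f, ⟨e⟩⟩
    rw [← hcard, Fintype.card_congr e.toEquiv, Fintype.card_fin]
  have hcb : ∀ {k l : ℕ}, Nonempty (G ≃g completeBipartiteGraph (Fin k) (Fin l)) → n = k + l := by
    rintro k l ⟨e⟩
    rw [← hcard, Fintype.card_congr e.toEquiv, Fintype.card_sum, Fintype.card_fin,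
      Fintype.card_fin]
  generalize determinantalDivisor (G.lapMatrix ℤ) 3 = D at *
  have hle : ∀ d, n ≤ d + 3 → d ∣ D → d ≤ n := by
    intro d hd hdvd
    rcases hext d hd hdvd with ⟨-, h⟩ | ⟨-, h⟩ | ⟨rfl, rfl, -⟩ | ⟨rfl, -⟩
    · exact Nat.le_of_dvd (by omega) h
    · exact (Nat.le_of_dvd (by omega) h).trans (Nat.sub_le _ _)
    · norm_num
    · omega
  -- The bound for all large divisors excludes `D = 0`, which every number divides.
  have hpos : 0 < D := by
    rw [Nat.pos_iff_ne_zero]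
    rintro rfl
    have := hle (n + 1) (by omega) (dvd_zero _)
    omega
  have hDn : D ≤ n := by
    by_contra hlt
    exact hlt (hle D (by omega) dvd_rfl)
  have hedge' : IsCompleteMinus G n (⊤ : SimpleGraph (Fin 2)) → D = n :=
    fun h => le_antisymm hDn (Nat.le_of_dvd hpos (hedge h))
  have hpend' : IsPendantComplete G (n - 1) → D = n - 1 := by
    intro h
    obtain ⟨k, hk⟩ := hpend h
    -- `0 < D ≤ n < 2 * (n - 1)`
    obtain rfl : k = 1 := by
      have h1 : k < 2 := by
        by_contra hk2
        have : (n - 1) * 2 ≤ (n - 1) * k := Nat.mul_le_mul_left _ (by omega)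
        omega
      have h2 : k ≠ 0 := by
        rintro rfl
        omega
      omega
    omega
  refine ⟨hDn, ⟨fun hD => ?_, hedge'⟩, ⟨fun hD => ?_, hpend'⟩, ⟨fun hD => ?_, ?_⟩,
    ⟨fun hD => ?_, ?_⟩⟩
  · rcases hext D (by omega) dvd_rfl with ⟨h, -⟩ | ⟨h, -⟩ | ⟨h, h', -⟩ | ⟨h, -⟩
    · exact h
    · have := hpend' h
      omega
    · omega
    · omega
  · rcases hext D (by omega) dvd_rfl with ⟨h, -⟩ | ⟨h, -⟩ | ⟨h, h', -⟩ | ⟨h, -⟩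
    · have := hedge' h
      omega
    · exact h
    · omega
    · omega
  · rcases hext D (by omega) dvd_rfl with ⟨h, -⟩ | ⟨h, -⟩ | ⟨h, -, h'⟩ | ⟨h, -⟩
    · have := hedge' h
      omega
    · have := hpend' h
      omega
    · exact ⟨h, h'⟩
    · omega
  · rintro ⟨rfl, h | h⟩
    · have := h2e h
      omega
    · have := hc4 h
      omega
  · rcases hext D (by omega) dvd_rfl with ⟨h, -⟩ | ⟨h, -⟩ | ⟨h, h', -⟩ | ⟨-, h⟩
    · have := hedge' h
      omega
    · have := hpend' h
      omega
    · omega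
    · exact h
  · rintro (h | h | h | h | h | h)
    · have := h23 h
      have := hcb h
      omega
    · have := ht5 h
      have := hcm h
      omega
    · have := ht6 h
      have := hcm h
      omega
    · have := h2t h
      have := hcm h
      omega
    · have := h33 h
      have := hcb h
      omega
    · have := hb h
      have := hcm h
      omega
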